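/- A finite weighted directed multigraph $(G,\omega)=(V,E,\omega)$ has a finite vertex set $V$, a finite multiset $E$ of arcs with endpoints in $V$ (parallel arcs and loops are allowed) and a weight $\omega:E\to\mathbb N^+$. It is connected if any two vertices are joined by a path that may use arcs in either direction. A feedback arc set (FAS) is a set of arcs whose deletion leaves no directed cycle (a loop counts as a cycle); it is optimal if its total weight is minimal. The quotient $G/_\Gamma$ is defined as follows. Two arcs $e,f$ are equivalent if $e=f$ or if they are the first and the last arc of a directed path all of whose inner vertices have in-degree and out-degree one. The vertices of $G/_\Gamma$ are the vertices of $G$ of in-degree $>1$ or out-degree $>1$. For each equivalence class whose longest such path starts and ends at vertices $u,v$ of $G/_\Gamma$ there is one arc from $u$ to $v$; its weight is the minimum of $\omega$ over the class, and all other classes are dropped. The quotient $G/_\Phi$ has the vertices of $G$ and merges all arcs from $u$ to $v$, for each pair $(u,v)$ joined by at least one arc, into one arc whose weight is the sum of their weights. Put $G_0=G$ and $G_{k}=(G_{k-1}/_\Gamma)/_\Phi$ for $k\ge 1$, with the corresponding weights. The essential minor $(C,\delta)$ of $(G,\omega)$ is the term $G_K$ with $G_K=G_{K+1}$ at which this sequence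 becomes stationary (a multigraph without parallel arcs being identified with the digraph of the endpoint pairs of its arcs). Time is the number of elementary steps of a random access machine with unit-cost addition, subtraction, memory access and tests (no multiplication). Graphs on $\{0,\dots,|V|-1\}$ are given, and returned, as lists of the tails, heads and weights of their arcs. **Proposition.** (1) There is an algorithm which, for every finite connected weighted directed multigraph $(G,\omega)$, computes the essential minor $(C,\delta)$ in time $\mathcal O(|E|^2)$. (2) There is an algorithm which, given any such $(G,\omega)$ and an optimal FAS of $(C,\delta)$ (as a list of pairs of vertices), computes an optimal FAS of $(G,\omega)$ in time $\mathcal O(|E|^2)$. (For $E=\emptyset$ the bounds are read as $\mathcal O(1)$.) -/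

import Mathlib

/-- A finite weighted directed multigraph with vertices in `V` and arcs labelled by `E`.
Parallel arcs are distinct labels with the same endpoints; loops are allowed.
All weights of arcs are positive integers. -/
@[ext]
structure WDigraph (V E : Type*) where
  verts : Finset V
  arcs : Finset E
  tail : E → V
  head : E → V
  weight : E → ℕ
  tail_mem : ∀ e ∈ arcs, tail e ∈ verts
  head_mem : ∀ e ∈ arcs, head e ∈ verts
  weight_pos : ∀ e ∈ arcs, 0 < weight e

namespace WDigraph

/-- There is an arc of `A` from `u` to `v`. -/
def Joins {V E : Type*} (G : WDigraph V E) (A : Set E) (u v : V) : Prop :=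
  ∃ e ∈ A, G.tail e = u ∧ G.head e = v

/-- Any two vertices are joined by a path that may use arcs in either direction. -/
def Connected {V E : Type*} (G : WDigraph V E) : Prop :=
  ∀ u ∈ G.verts, ∀ v ∈ G.verts, Relation.EqvGen (G.Joins G.arcs) u v

/-- `S` is a feedback arc set: no directed cycle (loops included) survives its deletion. -/
def IsFAS {V E : Type*} (G : WDigraph V E) (S : Finset E) : Prop :=
  S ⊆ G.arcs ∧ ∀ v, ¬ Relation.TransGen (G.Joins {e | e ∈ G.arcs ∧ e ∉ S}) v v

/-- `S` is a feedback arc set of minimum total weight. -/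
def IsOptimalFAS {V E : Type*} (G : WDigraph V E) (S : Finset E) : Prop :=
  G.IsFAS S ∧ ∀ T, G.IsFAS T → ∑ e ∈ S, G.weight e ≤ ∑ e ∈ T, G.weight e

/-- Number of arcs entering `v`. -/
def inDeg {V E : Type*} [DecidableEq V] (G : WDigraph V E) (v : V) : ℕ :=
  (G.arcs.filter fun e => G.head e = v).card

/-- Number of arcs leaving `v`. -/
def outDeg {V E : Type*} [DecidableEq V] (G : WDigraph V E) (v : V) : ℕ :=
  (G.arcs.filter fun e => G.tail e = v).card

/-- `f` follows `e`, and the vertex between them has in-degree and out-degree one. -/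
def Next {V E : Type*} [DecidableEq V] (G : WDigraph V E) (e f : E) : Prop :=
  e ∈ G.arcs ∧ f ∈ G.arcs ∧ G.head e = G.tail f ∧
    G.inDeg (G.head e) = 1 ∧ G.outDeg (G.head e) = 1

/-- A directed branch-point-free path has first arc `e` and last arc `f`
(a single arc is such a path). -/
def BranchFree {V E : Type*} [DecidableEq V] (G : WDigraph V E) (e f : E) : Prop :=
  Relation.ReflTransGen G.Next e f

open Classical in
/-- The class of `e` under the relation "`e` and `f` are the two end arcs of a
branch-point-free path". -/
noncomputable def gammaClass {V E : Type*} [DecidableEq V] (G : WDigraph V E) (e : E) :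
    Finset E :=
  G.arcs.filter fun f => G.BranchFree e f ∨ G.BranchFree f e

/-- The longest branch-point-free path through `e` starts at `u` and ends at `v`. -/
def Spans {V E : Type*} [DecidableEq V] (G : WDigraph V E) (e : E) (u v : V) : Prop :=
  ∃ f g, G.BranchFree f e ∧ G.BranchFree e g ∧ (∀ d, ¬ G.Next d f) ∧ (∀ d, ¬ G.Next g d) ∧
    G.tail f = u ∧ G.head g = v

/-- The vertices with at least two entering or at least two leaving arcs. -/
def gammaVerts {V E : Type*} [DecidableEq V] (G : WDigraph V E) : Finset V :=
  G.verts.filter fun v => 1 < G.inDeg v ∨ 1 < G.outDeg v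

open Classical in
/-- The quotient contracting branch-point-free paths. An arc is a triple `(u, v, A)`, where
`A` is an equivalence class of arcs and `u`, `v` are the endpoints of its longest path;
only the classes with both endpoints in `gammaVerts` are kept. -/
noncomputable def gamma {V E : Type*} [DecidableEq V] (G : WDigraph V E) :
    WDigraph V (V × V × Finset E) where
  verts := G.gammaVerts
  arcs := (G.gammaVerts ×ˢ G.gammaVerts ×ˢ G.arcs.powerset).filter fun a =>
    ∃ e ∈ G.arcs, a.2.2 = G.gammaClass e ∧ G.Spans e a.1 a.2.1
  tail a := a.1
  head a := a.2.1
  weight a := sInf (G.weight '' (a.2.2 : Set E))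
  tail_mem a ha := by
    simp only [Finset.mem_filter, Finset.mem_product] at ha
    exact ha.1.1
  head_mem a ha := by
    simp only [Finset.mem_filter, Finset.mem_product] at ha
    exact ha.1.2.1
  weight_pos a ha := by
    simp only [Finset.mem_filter, Finset.mem_product] at ha
    obtain ⟨-, e, he, hA, -⟩ := ha
    have hmem : e ∈ (a.2.2 : Set E) := by
      rw [hA]
      exact Finset.mem_coe.2 (Finset.mem_filter.2 ⟨he, Or.inl Relation.ReflTransGen.refl⟩)
    have hne : (G.weight '' (a.2.2 : Set E)).Nonempty := ⟨G.weight e, e, hmem, rfl⟩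
    obtain ⟨f, hf, h⟩ := Nat.sInf_mem hne
    rw [← h]
    refine G.weight_pos f ?_
    rw [hA] at hf
    exact (Finset.mem_filter.1 (Finset.mem_coe.1 hf)).1

/-- The quotient merging parallel arcs and adding their weights. The class of all arcs from
`u` to `v` is the pair `(u, v)`. -/
def phi {V E : Type*} [DecidableEq V] (G : WDigraph V E) : WDigraph V (V × V) where
  verts := G.verts
  arcs := G.arcs.image fun e => (G.tail e, G.head e)
  tail p := p.1
  head p := p.2
  weight p := ∑ e ∈ G.arcs.filter (fun e => (G.tail e, G.head e) = p), G.weight e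
  tail_mem p hp := by
    obtain ⟨e, he, rfl⟩ := Finset.mem_image.1 hp
    exact G.tail_mem e he
  head_mem p hp := by
    obtain ⟨e, he, rfl⟩ := Finset.mem_image.1 hp
    exact G.head_mem e he
  weight_pos p hp := by
    obtain ⟨e, he, rfl⟩ := Finset.mem_image.1 hp
    exact Finset.sum_pos (fun f hf => G.weight_pos f (Finset.mem_filter.1 hf).1)
      ⟨e, Finset.mem_filter.2 ⟨he, rfl⟩⟩

/-- One round of the construction. -/
noncomputable def step {V E : Type*} [DecidableEq V] (G : WDigraph V E) : WDigraph V (V × V) :=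
  G.gamma.phi

/-- `C` is the term at which the sequence `G, step G, step (step G), …` becomes stationary.
The arcs of all terms from `step G` on are pairs of vertices; if `G` itself is unchanged by
`step` up to naming its arcs by their endpoints, then `C = step G`. -/
def IsEssentialMinor {V E : Type*} [DecidableEq V] (G : WDigraph V E)
    (C : WDigraph V (V × V)) : Prop :=
  ∃ K : ℕ, C = (step^[K]) G.step ∧ C.step = C

end WDigraph

/-! A random access machine with a finite control given by a structured program. The memory
consists of variables and arrays holding natural numbers. Addition, truncated subtraction,
memory access and branching have unit cost; there is no multiplication. -/

namespace Ram

/-- Contents of the variables and of the arrays. -/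
structure State where
  var : ℕ → ℕ
  arr : ℕ → ℕ → ℕ

inductive Expr where
  | lit (k : ℕ)
  | var (x : ℕ)
  | get (a : ℕ) (i : Expr)
  | add (p q : Expr)
  | sub (p q : Expr)

def Expr.eval (s : State) : Expr → ℕ
  | lit k => k
  | var x => s.var x
  | get a i => s.arr a (i.eval s)
  | add p q => p.eval s + q.eval s
  | sub p q => p.eval s - q.eval s

/-- One step for each operation. -/
def Expr.cost : Expr → ℕ
  | lit _ => 1
  | var _ => 1
  | get _ i => i.cost + 1
  | add p q => p.cost + q.cost + 1
  | sub p q => p.cost + q.cost + 1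

/-- Programs. A condition holds when its value is nonzero. -/
inductive Cmd where
  | skip
  | assign (x : ℕ) (e : Expr)
  | store (a : ℕ) (i e : Expr)
  | seq (p q : Cmd)
  | ite (b : Expr) (p q : Cmd)
  | loop (b : Expr) (p : Cmd)

def State.setVar (s : State) (x k : ℕ) : State :=
  { s with var := Function.update s.var x k }

def State.setArr (s : State) (a i k : ℕ) : State :=
  { s with arr := Function.update s.arr a (Function.update (s.arr a) i k) }

/-- `Exec p s t s'`: started in `s`, the program `p` halts in `s'` after exactly `t` steps. -/
inductive Exec : Cmd → State → ℕ → State → Prop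
  | skip (s : State) : Exec .skip s 1 s
  | assign (s : State) (x : ℕ) (e : Expr) :
      Exec (.assign x e) s (e.cost + 1) (s.setVar x (e.eval s))
  | store (s : State) (a : ℕ) (i e : Expr) :
      Exec (.store a i e) s (i.cost + e.cost + 1) (s.setArr a (i.eval s) (e.eval s))
  | seq {p q : Cmd} {s s₁ s₂ : State} {t₁ t₂ : ℕ} :
      Exec p s t₁ s₁ → Exec q s₁ t₂ s₂ → Exec (.seq p q) s (t₁ + t₂) s₂
  | ite_true {b : Expr} {p q : Cmd} {s s₁ : State} {t : ℕ} :
      b.eval s ≠ 0 → Exec p s t s₁ → Exec (.ite b p q) s (b.cost + 1 + t) s₁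
  | ite_false {b : Expr} {p q : Cmd} {s s₁ : State} {t : ℕ} :
      b.eval s = 0 → Exec q s t s₁ → Exec (.ite b p q) s (b.cost + 1 + t) s₁
  | loop_true {b : Expr} {p : Cmd} {s s₁ s₂ : State} {t₁ t₂ : ℕ} :
      b.eval s ≠ 0 → Exec p s t₁ s₁ → Exec (.loop b p) s₁ t₂ s₂ →
        Exec (.loop b p) s (b.cost + 1 + t₁ + t₂) s₂
  | loop_false {b : Expr} {p : Cmd} {s : State} :
      b.eval s = 0 → Exec (.loop b p) s (b.cost + 1) s

/-- The array that starts with the entries of `l` and is zero afterwards. -/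
def ofList (l : List ℕ) : ℕ → ℕ := fun i => l.getD i 0

/-- Array `a` starts with the entries of `l`. -/
def State.Holds (s : State) (a : ℕ) (l : List ℕ) : Prop :=
  ∀ i (h : i < l.length), s.arr a i = l[i]

/-- The input consisting of a weighted multigraph with vertex set `{0, …, n - 1}` and arcs
`0, …, m - 1`: the numbers `n`, `m` and the lists of tails, heads and weights. -/
def graphInput {n m : ℕ} (G : WDigraph (Fin n) (Fin m)) : State where
  var := ofList [n, m]
  arr
    | 0 => ofList (List.ofFn fun e => (G.tail e : ℕ))
    | 1 => ofList (List.ofFn fun e => (G.head e : ℕ))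
    | 2 => ofList (List.ofFn fun e => G.weight e)
    | _ => ofList []

/-- The input consisting of a weighted multigraph and a list of pairs of vertices. -/
def graphAndPairsInput {n m : ℕ} (G : WDigraph (Fin n) (Fin m)) (l : List (Fin n × Fin n)) :
    State where
  var := ofList [n, m, l.length]
  arr
    | 0 => ofList (List.ofFn fun e => (G.tail e : ℕ))
    | 1 => ofList (List.ofFn fun e => (G.head e : ℕ))
    | 2 => ofList (List.ofFn fun e => G.weight e)
    | 3 => ofList (l.map fun p => (p.1 : ℕ))
    | 4 => ofList (l.map fun p => (p.2 : ℕ))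
    | _ => ofList []

/-- The final memory describes the weighted digraph `C`: the number of arcs in variable `1`,
their tails, heads and weights in arrays `0`, `1`, `2`, the number of vertices in variable `0`
and the vertices in array `3`, everything listed exactly once. -/
def State.OutputsDigraph {n : ℕ} (s : State) (C : WDigraph (Fin n) (Fin n × Fin n)) : Prop :=
  (∃ vs : List (Fin n), vs.Nodup ∧ vs.toFinset = C.verts ∧
    s.var 0 = vs.length ∧ s.Holds 3 (vs.map fun v => (v : ℕ))) ∧
  (∃ as : List (Fin n × Fin n), as.Nodup ∧ as.toFinset = C.arcs ∧
    s.var 1 = as.length ∧ s.Holds 0 (as.map fun p => (C.tail p : ℕ)) ∧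
    s.Holds 1 (as.map fun p => (C.head p : ℕ)) ∧ s.Holds 2 (as.map fun p => C.weight p))

/-- The final memory describes the set `T` of arcs: their number in variable `0` and
the arcs in array `0`, each listed exactly once. -/
def State.OutputsArcs {m : ℕ} (s : State) (T : Finset (Fin m)) : Prop :=
  ∃ l : List (Fin m), l.Nodup ∧ l.toFinset = T ∧
    s.var 0 = l.length ∧ s.Holds 0 (l.map fun e => (e : ℕ))

end Ram

/-! A round depends on very little. The quotient by `phi` is determined by the vertices and the
matrix `mat` of total weights from `u` to `v`. After contraction this matrix is `gmat` with `S` the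
set of branch vertices: follow each arc leaving `u` in `S` through vertices outside `S` up to the
first vertex of `S`, and count the least weight met (`mat_gamma`). So no equivalence classes have to
be formed. Any moves that preserve the rows of `gmat` in `S` will do, until all arcs have both ends
in `S` and `gmat` is `mat`.

A vertex outside `S` has at most one entering and one leaving arc, and is eliminated in constant
time: a dead end or a loop is deleted, and an entering and a leaving arc are spliced into one that
keeps the label of the lighter (`gmat_dropArc`, `gmat_splice`). Then parallel arcs are merged
(`mat_mergeArc`). Each such deletion, splice or merge removes one label `k` and turns optimal
feedback arc sets of the smaller graph into those of the larger one: an arc at a dead end lies on no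
cycle, a loop must be cut, a path is cut at its lighter arc, and parallel arcs are cut together. One
forwarding pointer per arc records this: a living arc points to itself, a removed one to `m` (never
cut), to `m + 1` (always cut) or to the arc it was merged into. `Lift` is the resulting invariant
and `Lift.kill` treats all moves at once.

A round is a bounded number of passes over vertices and arcs. If it removes no arc it changes
nothing, so the sequence is stationary; hence `m + 2` rounds suffice. Connectedness gives `n ≤ m +
1`, which turns the total into a quadratic bound in `m`. For the second algorithm, each of the `m`
arcs is followed along `m` pointers and the arc reached is looked up in a list of at most `m` pairs.
-/

namespace WDigraph

/-! ### Weight matrices of the two quotients -/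

variable {V E E' : Type*}

/-- There is a path with first arc `e`, inner vertices outside `S`, last vertex `t` in `S`
and minimal weight `w`. -/
inductive Walk (X : WDigraph V E) (S : Finset V) : E → V → ℕ → Prop
  | last (e : E) : e ∈ X.arcs → X.head e ∈ S → Walk X S e (X.head e) (X.weight e)
  | cons (e f : E) (t : V) (w : ℕ) : e ∈ X.arcs → f ∈ X.arcs → X.head e = X.tail f →
      X.head e ∉ S → Walk X S f t w → Walk X S e t (min (X.weight e) w)

theorem Walk.mem {X : WDigraph V E} {S : Finset V} {e : E} {t : V} {w : ℕ}
    (h : X.Walk S e t w) : e ∈ X.arcs := by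
  cases h <;> assumption

theorem Walk.last' {X : WDigraph V E} {S : Finset V} {e : E} {t : V} {w : ℕ}
    (he : e ∈ X.arcs) (ht : X.head e = t) (hS : t ∈ S) (hw : w = X.weight e) :
    X.Walk S e t w := by
  subst ht hw
  exact .last e he hS

theorem Walk.cons' {X : WDigraph V E} {S : Finset V} {e f : E} {t : V} {w w' : ℕ}
    (he : e ∈ X.arcs) (hef : X.head e = X.tail f) (hS : X.head e ∉ S)
    (hf : X.Walk S f t w) (hw : w' = min (X.weight e) w) : X.Walk S e t w' := by
  subst hw
  exact .cons e f t w he hf.mem hef hS hf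

/-- No two arcs are parallel. -/
def Simple (X : WDigraph V E) : Prop :=
  ∀ e ∈ X.arcs, ∀ f ∈ X.arcs, X.tail e = X.tail f → X.head e = X.head f → e = f

variable [DecidableEq V]

/-- The total weight of the arcs from `u` to `v`. -/
def mat (X : WDigraph V E) (u v : V) : ℕ :=
  ∑ e ∈ X.arcs.filter (fun e => (X.tail e, X.head e) = (u, v)), X.weight e

/-- Weights are positive, so no cancellation hides an arc: `mat` determines the arc set of `phi` as
well as its weights. -/
theorem mat_pos_iff (X : WDigraph V E) (u v : V) :
    0 < X.mat u v ↔ ∃ e ∈ X.arcs, X.tail e = u ∧ X.head e = v := by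
  constructor
  · intro h
    obtain ⟨e, he, -⟩ := Finset.exists_ne_zero_of_sum_ne_zero h.ne'
    simp only [Finset.mem_filter, Prod.mk.injEq] at he
    exact ⟨e, he⟩
  · rintro ⟨e, he, hu, hv⟩
    exact Finset.sum_pos (fun f hf => X.weight_pos f (Finset.mem_filter.1 hf).1)
      ⟨e, Finset.mem_filter.2 ⟨he, by rw [hu, hv]⟩⟩

theorem mem_phi_arcs (X : WDigraph V E) (p : V × V) : p ∈ X.phi.arcs ↔ 0 < X.mat p.1 p.2 := by
  rw [mat_pos_iff]
  simp [phi, Prod.ext_iff]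

theorem phi_weight (X : WDigraph V E) (p : V × V) : X.phi.weight p = X.mat p.1 p.2 := rfl

theorem phi_eq {X : WDigraph V E} {Y : WDigraph V E'} (hv : X.verts = Y.verts)
    (hm : ∀ u v, X.mat u v = Y.mat u v) : X.phi = Y.phi := by
  apply WDigraph.ext
  · exact hv
  · ext p
    rw [mem_phi_arcs, mem_phi_arcs, hm]
  · rfl
  · rfl
  · funext p
    rw [phi_weight, phi_weight, hm]

/-- The matrix of weights after contraction of all paths with inner vertices outside `S`. -/
noncomputable def gmat (X : WDigraph V E) (S : Finset V) (u t : V) : ℕ :=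
  ∑ e ∈ X.arcs.filter (fun e => X.tail e = u), sInf {w | X.Walk S e t w}

theorem mem_gammaVerts (X : WDigraph V E) (v : V) : v ∈ X.gammaVerts ↔
    (∃ e ∈ X.arcs, ∃ f ∈ X.arcs, X.head e = v ∧ X.head f = v ∧ e ≠ f) ∨
    (∃ e ∈ X.arcs, ∃ f ∈ X.arcs, X.tail e = v ∧ X.tail f = v ∧ e ≠ f) := by
  unfold gammaVerts inDeg outDeg
  rw [Finset.mem_filter, Finset.one_lt_card, Finset.one_lt_card]
  simp only [Finset.mem_filter]
  constructor
  · rintro ⟨-, ⟨e, he, f, hf, h⟩ | ⟨e, he, f, hf, h⟩⟩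
    · exact Or.inl ⟨e, he.1, f, hf.1, he.2, hf.2, h⟩
    · exact Or.inr ⟨e, he.1, f, hf.1, he.2, hf.2, h⟩
  · rintro (⟨e, he, f, hf, h1, h2, h⟩ | ⟨e, he, f, hf, h1, h2, h⟩)
    · exact ⟨h1 ▸ X.head_mem e he, Or.inl ⟨e, ⟨he, h1⟩, f, ⟨hf, h2⟩, h⟩⟩
    · exact ⟨h1 ▸ X.tail_mem e he, Or.inr ⟨e, ⟨he, h1⟩, f, ⟨hf, h2⟩, h⟩⟩

/-- The arcs `e` and `f` already make both degrees at the middle vertex at least one, so being one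
means not exceeding one. -/
theorem next_iff (X : WDigraph V E) (e f : E) : X.Next e f ↔
    e ∈ X.arcs ∧ f ∈ X.arcs ∧ X.head e = X.tail f ∧ X.head e ∉ X.gammaVerts := by
  unfold Next
  constructor
  · rintro ⟨he, hf, h, h1, h2⟩
    refine ⟨he, hf, h, ?_⟩
    simp [gammaVerts, h1, h2]
  · rintro ⟨he, hf, h, hS⟩
    have hv := X.head_mem e he
    simp only [gammaVerts, Finset.mem_filter, hv, true_and, not_or, not_lt] at hS
    have h1 : 0 < X.inDeg (X.head e) := Finset.card_pos.2 ⟨e, by simp [he]⟩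
    have h2 : 0 < X.outDeg (X.head e) := Finset.card_pos.2 ⟨f, by simp [hf, h]⟩
    exact ⟨he, hf, h, by omega, by omega⟩

theorem next_right_unique (X : WDigraph V E) : Relator.RightUnique X.Next := by
  intro e f f' h h'
  rw [next_iff] at h h'
  by_contra hne
  exact h.2.2.2 ((X.mem_gammaVerts _).2
    (Or.inr ⟨f, h.2.1, f', h'.2.1, h.2.2.1.symm, h'.2.2.1.symm, hne⟩))

theorem next_left_unique (X : WDigraph V E) : Relator.RightUnique (Function.swap X.Next) := by
  intro f e e' h h'
  simp only [Function.swap] at h h'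
  rw [next_iff] at h h'
  by_contra hne
  exact h.2.2.2 ((X.mem_gammaVerts _).2
    (Or.inl ⟨e, h.1, e', h'.1, rfl, by rw [h'.2.2.1, h.2.2.1], hne⟩))

theorem BranchFree.mem {X : WDigraph V E} {e f : E} (h : X.BranchFree e f) (he : e ∈ X.arcs) :
    f ∈ X.arcs := by
  rcases Relation.ReflTransGen.cases_tail h with rfl | ⟨d, -, hd⟩
  · exact he
  · exact hd.2.1

theorem BranchFree.mem_left {X : WDigraph V E} {e f : E} (h : X.BranchFree e f)
    (hf : f ∈ X.arcs) : e ∈ X.arcs := by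
  rcases Relation.ReflTransGen.cases_head h with rfl | ⟨d, hd, -⟩
  · exact hf
  · exact hd.1

theorem BranchFree.eq_of_tail_mem {X : WDigraph V E} {e f : E} (h : X.BranchFree e f)
    (hf : X.tail f ∈ X.gammaVerts) : e = f := by
  rcases Relation.ReflTransGen.cases_tail h with rfl | ⟨d, -, hd⟩
  · rfl
  · rw [next_iff] at hd
    exact absurd (hd.2.2.1 ▸ hf) hd.2.2.2

/-- `Next` is a partial injection, so two branch-free paths with a common first or last arc are
comparable. -/
theorem BranchFree.gammaClass_eq {X : WDigraph V E} {f e : E} (h : X.BranchFree f e) :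
    X.gammaClass e = X.gammaClass f := by
  classical
  ext x
  simp only [gammaClass, Finset.mem_filter]
  refine and_congr_right fun _ => ⟨?_, ?_⟩
  · rintro (h1 | h1)
    · exact Or.inl (h.trans h1)
    · have h2 := Relation.ReflTransGen.total_of_right_unique X.next_left_unique
        (Relation.reflTransGen_swap.2 h) (Relation.reflTransGen_swap.2 h1)
      rcases h2 with h2 | h2
      · exact Or.inr (Relation.reflTransGen_swap.1 h2)
      · exact Or.inl (Relation.reflTransGen_swap.1 h2)
  · rintro (h1 | h1)
    · exact Relation.ReflTransGen.total_of_right_unique X.next_right_unique h h1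
    · exact Or.inr (h1.trans h)

/-- No arc precedes `f` under `Next` when its tail is a branch vertex, so `f` is the first arc of
its class. -/
theorem coe_gammaClass {X : WDigraph V E} {f : E} (hf : f ∈ X.arcs)
    (ht : X.tail f ∈ X.gammaVerts) : (X.gammaClass f : Set E) = {e | X.BranchFree f e} := by
  classical
  ext x
  simp only [gammaClass, Finset.coe_filter, Set.mem_ofPred_eq]
  constructor
  · rintro ⟨-, h | h⟩
    · exact h
    · rw [h.eq_of_tail_mem ht]
      exact .refl
  · intro h
    exact ⟨h.mem hf, Or.inl h⟩

/-- Successors under `Next` are unique, so a walk from `f` runs through everything reachable from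
`f`. In particular its weight is forced. -/
theorem Walk.spec {X : WDigraph V E} {f : E} {t : V} {w : ℕ} (h : X.Walk X.gammaVerts f t w) :
    (∃ g, X.BranchFree f g ∧ g ∈ X.arcs ∧ X.head g = t) ∧ t ∈ X.gammaVerts ∧
      sInf (X.weight '' {e | X.BranchFree f e}) = w := by
  induction h with
  | last e he hS =>
    refine ⟨⟨e, .refl, he, rfl⟩, hS, ?_⟩
    have : {x | X.BranchFree e x} = {e} := by
      ext x
      simp only [Set.mem_ofPred_eq, Set.mem_singleton_iff]
      constructor
      · intro h
        rcases Relation.ReflTransGen.cases_head h with rfl | ⟨d, hd, -⟩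
        · rfl
        · rw [next_iff] at hd
          exact absurd hS hd.2.2.2
      · rintro rfl
        exact .refl
    simp [this]
  | cons e f t w he hf hef hS hw ih =>
    obtain ⟨⟨g, hg, hga, hgt⟩, ht, hi⟩ := ih
    have hn : X.Next e f := (X.next_iff _ _).2 ⟨he, hf, hef, hS⟩
    refine ⟨⟨g, .head hn hg, hga, hgt⟩, ht, ?_⟩
    have : {x | X.BranchFree e x} = insert e {x | X.BranchFree f x} := by
      ext x
      simp only [Set.mem_ofPred_eq, Set.mem_insert_iff]
      constructor
      · intro h
        rcases Relation.ReflTransGen.cases_head h with rfl | ⟨d, hd, h'⟩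
        · exact Or.inl rfl
        · rw [X.next_right_unique hd hn] at h'
          exact Or.inr h'
      · rintro (rfl | h)
        · exact .refl
        · exact .head hn h
    rw [this, Set.image_insert_eq, csInf_insert (OrderBot.bddBelow _), hi]
    exact ⟨_, f, Relation.ReflTransGen.refl, rfl⟩

theorem BranchFree.exists_walk {X : WDigraph V E} {f g : E} (h : X.BranchFree f g)
    (hg : g ∈ X.arcs) (hS : X.head g ∈ X.gammaVerts) :
    ∃ w, X.Walk X.gammaVerts f (X.head g) w := by
  induction h using Relation.ReflTransGen.head_induction_on with
  | refl => exact ⟨_, .last g hg hS⟩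
  | head h1 h2 ih =>
    obtain ⟨w, hw⟩ := ih
    rw [next_iff] at h1
    exact ⟨_, .cons _ _ _ w h1.1 h1.2.1 h1.2.2.1 h1.2.2.2 hw⟩

/-- A kept class corresponds to its first arc, which leaves a branch vertex; cyclic classes have no
first arc and are dropped on both sides. -/
theorem mat_gamma (X : WDigraph V E) (u t : V) :
    X.gamma.mat u t = if u ∈ X.gammaVerts then X.gmat X.gammaVerts u t else 0 := by
  classical
  split_ifs with hu
  · unfold gmat mat
    symm
    -- Arcs whose walk does not end in `t` contribute `sInf ∅ = 0`.
    rw [← Finset.sum_filter_of_ne (p := fun f => ∃ w, X.Walk X.gammaVerts f t w)]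
    · refine Finset.sum_nbij (fun f => (u, t, X.gammaClass f)) ?_ ?_ ?_ ?_
      · intro f hf
        simp only [Finset.mem_filter] at hf
        obtain ⟨⟨hf, rfl⟩, w, hw⟩ := hf
        obtain ⟨⟨g, hg, hga, rfl⟩, ht, -⟩ := hw.spec
        refine Finset.mem_filter.2 ⟨Finset.mem_filter.2 ⟨?_, f, hf, rfl, f, g, .refl, hg, ?_, ?_,
          rfl, rfl⟩, rfl⟩
        · exact Finset.mem_product.2 ⟨hu, Finset.mem_product.2 ⟨ht, Finset.mem_powerset.2
            (Finset.filter_subset _ _)⟩⟩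
        · intro d hd
          rw [next_iff] at hd
          exact hd.2.2.2 (hd.2.2.1 ▸ hu)
        · intro d hd
          rw [next_iff] at hd
          exact hd.2.2.2 ht
      · intro f hf f' hf' h
        simp only [Finset.coe_filter, Finset.mem_filter, Set.mem_ofPred_eq] at hf hf'
        simp only [Prod.mk.injEq, true_and] at h
        have h1 : f' ∈ (X.gammaClass f : Set E) := by
          rw [h, coe_gammaClass hf'.1.1 (hf'.1.2 ▸ hu)]
          exact .refl
        rw [coe_gammaClass hf.1.1 (hf.1.2 ▸ hu)] at h1
        exact BranchFree.eq_of_tail_mem h1 (hf'.1.2 ▸ hu)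
      · rintro ⟨u', t', A⟩ ha
        simp only [gamma, Finset.coe_filter, Finset.mem_filter, Finset.mem_product, Prod.mk.injEq,
          Set.mem_ofPred_eq] at ha
        obtain ⟨⟨⟨-, ht, -⟩, e, he, rfl, f, g, hfe, heg, -, -, hf, hg⟩, rfl, rfl⟩ := ha
        have hfa := hfe.mem_left he
        obtain ⟨w, hw⟩ := BranchFree.exists_walk (hfe.trans heg) (heg.mem he) (hg ▸ ht)
        refine ⟨f, ?_, ?_⟩
        · simp only [Finset.coe_filter, Finset.mem_filter, Set.mem_ofPred_eq]
          exact ⟨⟨hfa, hf⟩, w, hg ▸ hw⟩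
        · simp only [hfe.gammaClass_eq]
      · intro f hf
        simp only [Finset.mem_filter] at hf
        obtain ⟨⟨hf, rfl⟩, w, hw⟩ := hf
        have h1 : {w | X.Walk X.gammaVerts f t w} = {w} := by
          ext w'
          simp only [Set.mem_ofPred_eq, Set.mem_singleton_iff]
          constructor
          · intro h
            rw [← h.spec.2.2, hw.spec.2.2]
          · rintro rfl
            exact hw
        rw [h1, csInf_singleton, ← hw.spec.2.2]
        simp only [gamma]
        rw [coe_gammaClass hf hu]
    · intro f _ hne
      obtain ⟨w, hw⟩ := Nat.nonempty_of_sInf_eq_succ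
        (Nat.succ_pred_eq_of_pos (Nat.pos_of_ne_zero hne)).symm
      exact ⟨w, hw⟩
  · by_contra h
    obtain ⟨e, he, rfl, -⟩ := (mat_pos_iff _ _ _).1 (Nat.pos_of_ne_zero h)
    exact hu (X.gamma.tail_mem e he)

theorem step_eq {X : WDigraph V E} {Y : WDigraph V E'} (hS : X.gammaVerts = Y.gammaVerts)
    (hm : ∀ u ∈ X.gammaVerts, ∀ t, X.gmat X.gammaVerts u t = Y.gmat X.gammaVerts u t) :
    X.step = Y.step := by
  refine phi_eq hS fun u t => ?_
  rw [mat_gamma, mat_gamma, ← hS]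
  split_ifs with h
  · exact hm u h t
  · rfl

/-- Branch vertices and walks see only the arcs, so the vertex sets need not agree. This allows the
algorithm to leave isolated vertices in place. -/
theorem step_congr [DecidableEq E'] {X : WDigraph V E} {Y : WDigraph V E'} (φ : E → E')
    (hφ : Set.InjOn φ X.arcs) (ha : Y.arcs = X.arcs.image φ)
    (ht : ∀ e ∈ X.arcs, Y.tail (φ e) = X.tail e) (hh : ∀ e ∈ X.arcs, Y.head (φ e) = X.head e)
    (hw : ∀ e ∈ X.arcs, Y.weight (φ e) = X.weight e) : X.step = Y.step := by
  have hS : X.gammaVerts = Y.gammaVerts := by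
    ext v
    simp only [mem_gammaVerts, ha, Finset.exists_mem_image]
    refine or_congr ?_ ?_
    · refine exists_congr fun e => and_congr_right fun he => exists_congr fun f =>
        and_congr_right fun hf => ?_
      rw [hh e he, hh f hf, Ne, Ne, hφ.eq_iff he hf]
    · refine exists_congr fun e => and_congr_right fun he => exists_congr fun f =>
        and_congr_right fun hf => ?_
      rw [ht e he, ht f hf, Ne, Ne, hφ.eq_iff he hf]
  refine step_eq hS fun u _ t => ?_
  generalize X.gammaVerts = S
  have h1 : ∀ e t w, X.Walk S e t w → Y.Walk S (φ e) t w := by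
    intro e t w h
    induction h with
    | last e he h =>
      exact .last' (by rw [ha]; exact Finset.mem_image_of_mem _ he) (hh e he) h (hw e he).symm
    | cons e f t w he hf hef hS _ ih =>
      exact .cons' (by rw [ha]; exact Finset.mem_image_of_mem _ he)
        (by rw [hh e he, ht f hf, hef]) (by rwa [hh e he]) ih (by rw [hw e he])
  have h2 : ∀ e' t w, Y.Walk S e' t w → ∀ e ∈ X.arcs, φ e = e' → X.Walk S e t w := by
    intro e t w h
    induction h with
    | last e' _ h =>
      rintro e he rfl
      rw [hh e he] at h
      exact .last' he (hh e he).symm (by rwa [hh e he]) (hw e he)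
    | cons e' f' t w _ hf hef hS _ ih =>
      rintro e he rfl
      rw [ha] at hf
      obtain ⟨f, hfX, rfl⟩ := Finset.mem_image.1 hf
      rw [hh e he] at hef hS
      rw [ht f hfX] at hef
      exact .cons' he hef hS (ih f hfX rfl) (by rw [hw e he])
  unfold gmat
  rw [ha, Finset.filter_image, Finset.sum_image]
  · refine Finset.sum_congr ?_ fun e he => ?_
    · ext e
      simp only [Finset.mem_filter]
      exact and_congr_right fun he => by rw [ht e he]
    · simp only [Finset.mem_filter] at he
      congr 1
      ext w
      exact ⟨h1 e t w, fun h => h2 _ t w h e he.1 rfl⟩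
  · intro e he f hf
    simp only [Finset.coe_filter, Set.mem_ofPred_eq] at he hf
    exact hφ he.1 hf.1

theorem Simple.mat_eq {X : WDigraph V E} (h : X.Simple) {e : E} (he : e ∈ X.arcs) :
    X.mat (X.tail e) (X.head e) = X.weight e := by
  unfold mat
  rw [Finset.sum_eq_single e]
  · intro f hf hne
    simp only [Finset.mem_filter, Prod.mk.injEq] at hf
    exact absurd (h f hf.1 e he hf.2.1 hf.2.2) hne
  · intro hn
    simp [he] at hn

/-- A graph without parallel arcs and with the weight matrix of `step X` has the same next term. -/
theorem Simple.step_eq_step_phi {X : WDigraph V E} {Y : WDigraph V E'} (h : X.Simple)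
    (hm : ∀ u v, X.mat u v = Y.mat u v) : X.step = Y.phi.step := by
  refine step_congr (fun e => (X.tail e, X.head e)) ?_ ?_ (fun _ _ => rfl) (fun _ _ => rfl) ?_
  · intro e he f hf hef
    simp only [Prod.mk.injEq] at hef
    exact h e he f hf hef.1 hef.2
  · ext p
    rw [mem_phi_arcs, ← hm, ← mem_phi_arcs]
    rfl
  · intro e he
    rw [phi_weight, ← hm]
    exact h.mat_eq he

/-- Every walk stops after its first arc. This is the state reached when all vertices outside `S`
are eliminated. -/
theorem gmat_eq_mat {X : WDigraph V E} {S : Finset V} (hS : ∀ e ∈ X.arcs, X.head e ∈ S)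
    (u t : V) : X.gmat S u t = X.mat u t := by
  unfold gmat mat
  have h : ∀ e ∈ X.arcs, {w | X.Walk S e t w} = if X.head e = t then {X.weight e} else ∅ := by
    intro e he
    ext w
    constructor
    · intro h
      cases h with
      | last => simp
      | cons _ _ _ _ _ _ _ h => exact absurd (hS e he) h
    · split_ifs with ht
      · rintro rfl
        exact .last' he ht (ht ▸ hS e he) rfl
      · simp
  rw [← Finset.sum_filter_of_ne (p := fun e => X.head e = t)]
  · rw [Finset.filter_filter]
    refine Finset.sum_congr ?_ fun e he => ?_
    · ext e
      simp
    · simp only [Finset.mem_filter, Prod.mk.injEq] at he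
      rw [h e he.1, if_pos he.2.2, csInf_singleton]
  · intro e he hne
    by_contra ht
    rw [h e (Finset.mem_filter.1 he).1, if_neg ht] at hne
    simp at hne

/-! ### Elementary reductions and the contracted matrix -/

section Reductions

variable [DecidableEq E]

/-- Delete the arc `k`. -/
def dropArc (X : WDigraph V E) (k : E) : WDigraph V E where
  verts := X.verts
  arcs := X.arcs.erase k
  tail := X.tail
  head := X.head
  weight := X.weight
  tail_mem e he := X.tail_mem e (Finset.mem_of_mem_erase he)
  head_mem e he := X.head_mem e (Finset.mem_of_mem_erase he)
  weight_pos e he := X.weight_pos e (Finset.mem_of_mem_erase he)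

/-- Delete the arc `k` and let the arc `l` go from the tail of `e` to the head of `f`. -/
def splice (X : WDigraph V E) (e f l k : E) (he : e ∈ X.arcs) (hf : f ∈ X.arcs) :
    WDigraph V E where
  verts := X.verts
  arcs := X.arcs.erase k
  tail := Function.update X.tail l (X.tail e)
  head := Function.update X.head l (X.head f)
  weight := X.weight
  tail_mem g hg := by
    rw [Function.update_apply]
    split_ifs
    · exact X.tail_mem e he
    · exact X.tail_mem g (Finset.mem_of_mem_erase hg)
  head_mem g hg := by
    rw [Function.update_apply]
    split_ifs
    · exact X.head_mem f hf
    · exact X.head_mem g (Finset.mem_of_mem_erase hg)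
  weight_pos e he := X.weight_pos e (Finset.mem_of_mem_erase he)

/-- Delete the arc `k` and add its weight to the arc `c`. -/
def mergeArc (X : WDigraph V E) (c k : E) : WDigraph V E where
  verts := X.verts
  arcs := X.arcs.erase k
  tail := X.tail
  head := X.head
  weight := Function.update X.weight c (X.weight c + X.weight k)
  tail_mem e he := X.tail_mem e (Finset.mem_of_mem_erase he)
  head_mem e he := X.head_mem e (Finset.mem_of_mem_erase he)
  weight_pos e he := by
    have h := X.weight_pos e (Finset.mem_of_mem_erase he)
    rw [Function.update_apply]
    split_ifs with hc
    · subst hc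
      omega
    · exact h

/-- By `h1` no walk from another arc runs through `k`; by `h2` the arc `k` itself contributes
nothing to a row in `S`. -/
theorem gmat_dropArc {X : WDigraph V E} {S : Finset V} {k : E}
    (h1 : (∀ g ∈ X.arcs, g ≠ k → X.head g ≠ X.tail k) ∨ ∀ t w, ¬ X.Walk S k t w)
    (h2 : X.tail k ∉ S ∨ ∀ t w, ¬ X.Walk S k t w) {u : V} (hu : u ∈ S) (t : V) :
    (X.dropArc k).gmat S u t = X.gmat S u t := by
  have hw : ∀ g, g ≠ k → ∀ w, (X.dropArc k).Walk S g t w ↔ X.Walk S g t w := by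
    intro g hg w
    constructor
    · intro h
      clear hg
      induction h with
      | last e he hS => exact .last' (Finset.mem_of_mem_erase he) rfl hS rfl
      | cons e f t w he hf hef hS _ ih =>
        exact .cons' (Finset.mem_of_mem_erase he) hef hS ih rfl
    · intro h
      induction h with
      | last e he hS => exact .last' (Finset.mem_erase.2 ⟨hg, he⟩) rfl hS rfl
      | cons e f t w he hf hef hS hw ih =>
        refine .cons' (Finset.mem_erase.2 ⟨hg, he⟩) hef hS (ih ?_) rfl
        rintro rfl
        rcases h1 with h1 | h1
        · exact h1 e he hg hef
        · exact h1 t w hw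
  unfold gmat
  refine Finset.sum_subset_zero_on_sdiff ?_ ?_ ?_
  · intro e he
    obtain ⟨he, hu⟩ := Finset.mem_filter.1 he
    exact Finset.mem_filter.2 ⟨Finset.mem_of_mem_erase he, hu⟩
  · intro e he
    rw [Finset.mem_sdiff, Finset.mem_filter, Finset.mem_filter] at he
    have hek : e = k := by
      by_contra hne
      exact he.2 ⟨Finset.mem_erase.2 ⟨hne, he.1.1⟩, he.1.2⟩
    subst hek
    rcases h2 with h2 | h2
    · exact absurd (he.1.2 ▸ hu) h2
    · simp [h2]
  · intro e he
    have hne := (Finset.mem_erase.1 (Finset.mem_filter.1 he).1).1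
    congr 1
    ext w
    exact hw e hne w

/-- A walk through the vertex between `e` and `f` must use `e` and then `f`. The spliced arc
replaces this pair, and the weight of the lighter arc is the minimum of the two. -/
theorem gmat_splice {X : WDigraph V E} {S : Finset V} {e f l k : E} (he : e ∈ X.arcs)
    (hf : f ∈ X.arcs) (hlk : l = e ∧ k = f ∨ l = f ∧ k = e) (hef : e ≠ f)
    (hv : X.head e = X.tail f) (hS : X.head e ∉ S)
    (hin : ∀ g ∈ X.arcs, X.head g = X.head e → g = e)
    (hout : ∀ g ∈ X.arcs, X.tail g = X.head e → g = f)
    (hle : X.weight l ≤ X.weight k) {u : V} (hu : u ∈ S) (t : V) :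
    (X.splice e f l k he hf).gmat S u t = X.gmat S u t := by
  set Y := X.splice e f l k he hf with hY
  have hlne : l ≠ k := by
    rcases hlk with ⟨rfl, rfl⟩ | ⟨rfl, rfl⟩
    · exact hef
    · exact hef.symm
  have hne : ∀ g, g ≠ l → g ≠ k → g ≠ e ∧ g ≠ f := by
    rcases hlk with ⟨rfl, rfl⟩ | ⟨rfl, rfl⟩
    · exact fun g h1 h2 => ⟨h1, h2⟩
    · exact fun g h1 h2 => ⟨h2, h1⟩
  have hne' : ∀ g, g ≠ e → g ≠ f → g ≠ l ∧ g ≠ k := by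
    rcases hlk with ⟨rfl, rfl⟩ | ⟨rfl, rfl⟩
    · exact fun g h1 h2 => ⟨h1, h2⟩
    · exact fun g h1 h2 => ⟨h2, h1⟩
  have hla : l ∈ Y.arcs := by
    refine Finset.mem_erase.2 ⟨hlne, ?_⟩
    rcases hlk with ⟨rfl, rfl⟩ | ⟨rfl, rfl⟩ <;> assumption
  have hga : ∀ g ∈ X.arcs, g ≠ k → g ∈ Y.arcs := fun g hg h => Finset.mem_erase.2 ⟨h, hg⟩
  have htl : Y.tail l = X.tail e := Function.update_self ..
  have hhl : Y.head l = X.head f := Function.update_self ..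
  have htg : ∀ g, g ≠ l → Y.tail g = X.tail g := fun g hg => Function.update_of_ne hg ..
  have hhg : ∀ g, g ≠ l → Y.head g = X.head g := fun g hg => Function.update_of_ne hg ..
  have hwl : Y.weight l = min (X.weight e) (X.weight f) := by
    change X.weight l = _
    rcases hlk with ⟨rfl, rfl⟩ | ⟨rfl, rfl⟩
    · exact (min_eq_left hle).symm
    · exact (min_eq_right hle).symm
  have hwg : ∀ g, Y.weight g = X.weight g := fun _ => rfl
  have hff : X.head f ≠ X.tail f := fun h => hef (hin f hf (h.trans hv.symm)).symm
  -- The clause for `f` prepends `e` to the walk: this is what the induction needs when a walk goes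
  -- from `e` to `f`.
  have h1 : ∀ g t w, X.Walk S g t w → (g ≠ e → g ≠ f → Y.Walk S g t w) ∧
      (g = e → Y.Walk S l t w) ∧ (g = f → Y.Walk S l t (min (X.weight e) w)) := by
    intro g t w h
    induction h with
    | last g hg h =>
      refine ⟨fun h1 h2 => ?_, ?_, ?_⟩
      · obtain ⟨h3, h4⟩ := hne' g h1 h2
        exact .last' (hga g hg h4) (hhg g h3) h rfl
      · rintro rfl
        exact absurd h hS
      · rintro rfl
        exact .last' hla hhl h hwl.symm
    | cons g g' t w hg hg' hgg hgS hw ih =>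
      obtain ⟨ih1, ih2, ih3⟩ := ih
      refine ⟨fun h1 h2 => ?_, ?_, ?_⟩
      · obtain ⟨h3, h4⟩ := hne' g h1 h2
        have hg'f : g' ≠ f := by
          rintro rfl
          exact h1 (hin g hg (hgg.trans hv.symm))
        by_cases hg'e : g' = e
        · exact .cons' (hga g hg h4) (by rw [hhg g h3, htl, hgg, hg'e]) (by rwa [hhg g h3])
            (ih2 hg'e) rfl
        · exact .cons' (hga g hg h4) (by rw [hhg g h3, htg g' (hne' g' hg'e hg'f).1, hgg])
            (by rwa [hhg g h3]) (ih1 hg'e hg'f) rfl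
      · rintro rfl
        exact ih3 (hout g' hg' hgg.symm)
      · rintro rfl
        have hg'f : g' ≠ g := by
          rintro rfl
          exact hff hgg
        by_cases hg'e : g' = e
        · exact .cons' hla (by rw [hhl, htl, hgg, hg'e]) (by rwa [hhl]) (ih2 hg'e)
            (by rw [hwl, min_assoc])
        · exact .cons' hla (by rw [hhl, htg g' (hne' g' hg'e hg'f).1, hgg]) (by rwa [hhl])
            (ih1 hg'e hg'f) (by rw [hwl, min_assoc])
  have h2 : ∀ g t w, Y.Walk S g t w → (g ≠ l → X.Walk S g t w) ∧ (g = l → X.Walk S e t w) := by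
    intro g t w h
    induction h with
    | last g hg h =>
      have hgX : g ∈ X.arcs := Finset.mem_of_mem_erase hg
      refine ⟨fun h1 => ?_, ?_⟩
      · rw [hhg g h1] at h ⊢
        exact .last' hgX rfl h rfl
      · rintro rfl
        rw [hhl] at h ⊢
        exact .cons' he hv hS (.last' hf rfl h rfl) hwl
    | cons g g' t w hg hg' hgg hgS hw ih =>
      obtain ⟨ih1, ih2⟩ := ih
      have hgX : g ∈ X.arcs := Finset.mem_of_mem_erase hg
      refine ⟨fun h1 => ?_, ?_⟩
      · rw [hhg g h1] at hgg hgS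
        by_cases hg'l : g' = l
        · rw [hg'l, htl] at hgg
          exact .cons' hgX hgg hgS (ih2 hg'l) rfl
        · rw [htg g' hg'l] at hgg
          exact .cons' hgX hgg hgS (ih1 hg'l) rfl
      · rintro rfl
        rw [hhl] at hgg hgS
        rw [hwl, min_assoc]
        refine .cons' he hv hS ?_ rfl
        by_cases hg'l : g' = g
        · rw [hg'l, htl] at hgg
          exact .cons' hf hgg hgS (ih2 hg'l) rfl
        · rw [htg g' hg'l] at hgg
          exact .cons' hf hgg hgS (ih1 hg'l) rfl
  have hrest : (Y.arcs.erase l) = (X.arcs.erase e).erase f := by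
    ext g
    simp only [hY, splice, Finset.mem_erase]
    rcases hlk with ⟨rfl, rfl⟩ | ⟨rfl, rfl⟩ <;> tauto
  unfold gmat
  -- The arc `l` takes the term of `e`, while `f` has no term because its tail is outside `S`.
  rw [Finset.sum_filter, Finset.sum_filter, ← Finset.add_sum_erase _ _ hla, hrest,
    ← Finset.add_sum_erase _ _ he,
    ← Finset.add_sum_erase (X.arcs.erase e) _ (Finset.mem_erase.2 ⟨hef.symm, hf⟩), htl,
    if_neg (c := X.tail f = u), zero_add]
  · congr 1
    · have : {w | Y.Walk S l t w} = {w | X.Walk S e t w} := by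
        ext w
        exact ⟨fun h => (h2 _ _ _ h).2 rfl, fun h => (h1 _ _ _ h).2.1 rfl⟩
      rw [this]
    · refine Finset.sum_congr rfl fun g hg => ?_
      simp only [Finset.mem_erase] at hg
      obtain ⟨h3, h4⟩ := hne' g hg.2.1 hg.1
      have : {w | Y.Walk S g t w} = {w | X.Walk S g t w} := by
        ext w
        exact ⟨fun h => (h2 _ _ _ h).1 h3, fun h => (h1 _ _ _ h).1 hg.2.1 hg.1⟩
      rw [this, htg g h3]
  · intro h
    exact hS (by rw [hv, h]; exact hu)

theorem mat_mergeArc {X : WDigraph V E} {c k : E} (hc : c ∈ X.arcs) (hk : k ∈ X.arcs)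
    (hne : c ≠ k) (ht : X.tail c = X.tail k) (hh : X.head c = X.head k) (u t : V) :
    (X.mergeArc c k).mat u t = X.mat u t := by
  have hc' : c ∈ X.arcs.erase k := Finset.mem_erase.2 ⟨hne, hc⟩
  unfold mat
  rw [Finset.sum_filter, Finset.sum_filter]
  change ∑ e ∈ X.arcs.erase k, (if (X.tail e, X.head e) = (u, t) then
    Function.update X.weight c (X.weight c + X.weight k) e else 0) = _
  rw [← Finset.add_sum_erase _ _ hc',
    ← Finset.add_sum_erase X.arcs _ hk, ← Finset.add_sum_erase (X.arcs.erase k) _ hc']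
  rw [Finset.sum_congr rfl (g := fun e => if (X.tail e, X.head e) = (u, t) then X.weight e else 0)]
  · rw [Function.update_self, ht, hh]
    split_ifs <;> ring
  · intro e he
    rw [Function.update_of_ne (Finset.mem_erase.1 he).1]

end Reductions

end WDigraph

/-! ### Operations that create no cycle -/

section Acyclic

variable {V : Type*} {R R' : V → V → Prop}

/-- Nothing enters `p`, so a path starting elsewhere never visits `p` and uses only `R'`. -/
theorem Relation.acyclic_of_source {p : V} (h : ∀ a b, R a b → a = p ∨ R' a b)
    (hp : ∀ a, ¬ R a p) (hR : ∀ a, ¬ TransGen R' a a) (a : V) : ¬ TransGen R a a := by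
  have key : ∀ a b, TransGen R a b → a ≠ p → TransGen R' a b := by
    intro a b hab
    induction hab using TransGen.head_induction_on with
    | single hab => exact fun ha => .single ((h _ _ hab).resolve_left ha)
    | head hac _ ih =>
      intro ha
      refine .head ((h _ _ hac).resolve_left ha) (ih ?_)
      rintro rfl
      exact hp _ hac
  intro ha
  refine hR a (key a a ha ?_)
  rintro rfl
  obtain ⟨c, -, hc⟩ := TransGen.tail'_iff.1 ha
  exact hp c hc

theorem Relation.acyclic_of_sink {p : V} (h : ∀ a b, R a b → b = p ∨ R' a b)
    (hp : ∀ a, ¬ R p a) (hR : ∀ a, ¬ TransGen R' a a) (a : V) : ¬ TransGen R a a := by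
  intro ha
  refine acyclic_of_source (R := Function.swap R) (R' := Function.swap R') (p := p)
    (fun a b hab => h b a hab) hp (fun a ha => hR a (transGen_swap.1 ha)) a (transGen_swap.2 ha)

/-- Each passage through `v` is replaced by a shortcut in `R'`. A cycle based at `v` is first
rotated to another of its vertices. -/
theorem Relation.acyclic_of_bypass {v : V} (h1 : ∀ a b, R a b → a ≠ v → b ≠ v → R' a b)
    (h2 : ∀ a b, R a v → R v b → R' a b) (hv : ¬ R v v) (hR : ∀ a, ¬ TransGen R' a a) (a : V) :
    ¬ TransGen R a a := by
  -- While the path stands at `v`, its predecessor `c` is remembered until the next step completes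
  -- the shortcut.
  have key : ∀ a b, TransGen R a b → a ≠ v → (b ≠ v → TransGen R' a b) ∧
      (b = v → ∃ c, R c v ∧ ReflTransGen R' a c) := by
    intro a b hab ha
    induction hab with
    | single hab =>
      refine ⟨fun hb => .single (h1 _ _ hab ha hb), ?_⟩
      rintro rfl
      exact ⟨a, hab, .refl⟩
    | @tail c b _ hcb ih =>
      by_cases hc : c = v
      · subst hc
        obtain ⟨d, hd, had⟩ := ih.2 rfl
        refine ⟨fun _ => .tail' had (h2 _ _ hd hcb), ?_⟩
        rintro rfl
        exact absurd hcb hv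
      · refine ⟨fun hb => (ih.1 hc).tail (h1 _ _ hcb hc hb), ?_⟩
        rintro rfl
        exact ⟨c, hcb, (ih.1 hc).to_reflTransGen⟩
  have key' : ∀ a, a ≠ v → ¬ TransGen R a a := fun a ha h => hR a ((key a a h ha).1 ha)
  intro ha
  by_cases hav : a = v
  · subst hav
    obtain ⟨x, hx, hxa⟩ := TransGen.head'_iff.1 ha
    refine key' x ?_ (.tail' hxa hx)
    rintro rfl
    exact hv hx
  · exact key' a hav ha

end Acyclic

/-! ### Optimal feedback arc sets under the reductions -/

namespace WDigraph

variable {V E : Type*}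

/-- The number `d` is the drop of the optimum. It is the weight of the loop when a loop is deleted,
and zero in all other reductions. -/
theorem IsOptimalFAS.transfer {X X' : WDigraph V E} {T T' : Finset E} (d : ℕ)
    (hT : X'.IsOptimalFAS T) (h : X.IsFAS T')
    (hw : ∑ e ∈ T', X.weight e ≤ ∑ e ∈ T, X'.weight e + d)
    (hback : ∀ U, X.IsFAS U → ∃ U', X'.IsFAS U' ∧
      ∑ e ∈ U', X'.weight e + d ≤ ∑ e ∈ U, X.weight e) : X.IsOptimalFAS T' := by
  refine ⟨h, fun U hU => ?_⟩
  obtain ⟨U', hU', hle⟩ := hback U hU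
  have := hT.2 U' hU'
  omega

/-- A feedback arc set can be pulled back along a map of arcs to paths. -/
theorem IsFAS.of_lift {X X' : WDigraph V E} {T T' : Finset E} (hT : X.IsFAS T)
    (hs : T' ⊆ X'.arcs) (h : ∀ e ∈ X'.arcs, e ∉ T' →
      Relation.TransGen (X.Joins {e | e ∈ X.arcs ∧ e ∉ T}) (X'.tail e) (X'.head e)) :
    X'.IsFAS T' := by
  refine ⟨hs, fun v hv => hT.2 v ?_⟩
  have hv' := Relation.TransGen.closed (r := X'.Joins {e | e ∈ X'.arcs ∧ e ∉ T'})
    (p := X.Joins {e | e ∈ X.arcs ∧ e ∉ T}) ?_ _ _ hv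
  · exact hv'
  · rintro _ _ ⟨e, ⟨he, heT⟩, rfl, rfl⟩
    exact h e he heT

theorem joins_single {X : WDigraph V E} {T : Finset E} {e : E} (he : e ∈ X.arcs) (heT : e ∉ T) :
    Relation.TransGen (X.Joins {e | e ∈ X.arcs ∧ e ∉ T}) (X.tail e) (X.head e) :=
  .single ⟨e, ⟨he, heT⟩, rfl, rfl⟩

variable [DecidableEq E]

/-- The arc `k` leaves a source or enters a sink, so it lies on no cycle. -/
theorem IsOptimalFAS.of_dropArc {X : WDigraph V E} {k : E} {T : Finset E}
    (h : (∀ g ∈ X.arcs, X.head g ≠ X.tail k) ∨ (∀ g ∈ X.arcs, X.tail g ≠ X.head k))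
    (hT : (X.dropArc k).IsOptimalFAS T) : X.IsOptimalFAS T := by
  refine hT.transfer 0 ⟨fun e he => Finset.mem_of_mem_erase (hT.1.1 he), ?_⟩ le_rfl ?_
  · rcases h with h | h
    · refine Relation.acyclic_of_source (p := X.tail k) ?_ ?_ hT.1.2
      · rintro _ _ ⟨e, ⟨he, heT⟩, rfl, rfl⟩
        by_cases hek : e = k
        · exact Or.inl (hek ▸ rfl)
        · exact Or.inr ⟨e, ⟨Finset.mem_erase.2 ⟨hek, he⟩, heT⟩, rfl, rfl⟩
      · rintro a ⟨e, ⟨he, -⟩, -, h'⟩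
        exact h e he h'
    · refine Relation.acyclic_of_sink (p := X.head k) ?_ ?_ hT.1.2
      · rintro _ _ ⟨e, ⟨he, heT⟩, rfl, rfl⟩
        by_cases hek : e = k
        · exact Or.inl (hek ▸ rfl)
        · exact Or.inr ⟨e, ⟨Finset.mem_erase.2 ⟨hek, he⟩, heT⟩, rfl, rfl⟩
      · rintro a ⟨e, ⟨he, -⟩, h', -⟩
        exact h e he h'
  · intro U hU
    refine ⟨U.erase k, hU.of_lift (Finset.erase_subset_erase _ hU.1) ?_, ?_⟩
    · intro e he heU
      obtain ⟨hek, he⟩ := Finset.mem_erase.1 he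
      exact joins_single he fun h => heU (Finset.mem_erase.2 ⟨hek, h⟩)
    · exact Finset.sum_le_sum_of_subset (Finset.erase_subset _ _)

theorem IsOptimalFAS.of_dropArc_loop {X : WDigraph V E} {k : E} {T : Finset E} (hk : k ∈ X.arcs)
    (h : X.head k = X.tail k) (hT : (X.dropArc k).IsOptimalFAS T) :
    X.IsOptimalFAS (insert k T) := by
  have hkT : k ∉ T := fun h => Finset.notMem_erase _ _ (hT.1.1 h)
  refine hT.transfer (X.weight k) (hT.1.of_lift ?_ ?_) ?_ ?_
  · exact Finset.insert_subset hk fun e he => Finset.mem_of_mem_erase (hT.1.1 he)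
  · intro e he heT
    simp only [Finset.mem_insert, not_or] at heT
    exact joins_single (X := X.dropArc k) (Finset.mem_erase.2 ⟨heT.1, he⟩) heT.2
  · rw [Finset.sum_insert hkT, add_comm]
    exact le_rfl
  · intro U hU
    have hkU : k ∈ U := by
      by_contra hkU
      have := joins_single hk hkU
      rw [h] at this
      exact hU.2 _ this
    refine ⟨U.erase k, hU.of_lift (Finset.erase_subset_erase _ hU.1) ?_, ?_⟩
    · intro e he heU
      obtain ⟨hek, he⟩ := Finset.mem_erase.1 he
      exact joins_single he fun h => heU (Finset.mem_erase.2 ⟨hek, h⟩)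
    · exact (Finset.sum_erase_add _ _ hkU).le

/-- Cutting only one of two parallel arcs is useless, since the other still joins the same vertices.
So a competitor `U` may be assumed to contain both or neither. -/
theorem IsOptimalFAS.of_mergeArc {X : WDigraph V E} {c k : E} {T : Finset E} (hc : c ∈ X.arcs)
    (hk : k ∈ X.arcs) (hne : c ≠ k) (ht : X.tail c = X.tail k) (hh : X.head c = X.head k)
    (hT : (X.mergeArc c k).IsOptimalFAS T) :
    X.IsOptimalFAS (if c ∈ T then insert k T else T) := by
  have hkT : k ∉ T := fun h => Finset.notMem_erase _ _ (hT.1.1 h)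
  have hsub : T ⊆ X.arcs := fun e he => Finset.mem_of_mem_erase (hT.1.1 he)
  have hw : ∀ A : Finset E, c ∉ A →
      ∑ e ∈ A, (X.mergeArc c k).weight e = ∑ e ∈ A, X.weight e := by
    intro A hA
    refine Finset.sum_congr rfl fun e he => Function.update_of_ne ?_ ..
    rintro rfl
    exact hA he
  have hw' : ∀ A : Finset E, c ∈ A → k ∉ A →
      ∑ e ∈ A, (X.mergeArc c k).weight e = ∑ e ∈ insert k A, X.weight e := by
    intro A hA hkA
    rw [Finset.sum_insert hkA, ← Finset.sum_erase_add _ _ hA, ← Finset.sum_erase_add _ _ hA,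
      hw _ (Finset.notMem_erase _ _)]
    simp only [mergeArc, Function.update_self]
    ring
  refine hT.transfer 0 (hT.1.of_lift ?_ ?_) ?_ ?_
  · split_ifs
    · exact Finset.insert_subset hk hsub
    · exact hsub
  · intro e he heT
    by_cases hek : e = k
    · subst hek
      have hcT : c ∉ T := by
        intro hcT
        simp [hcT] at heT
      have := joins_single (X := X.mergeArc c e) (Finset.mem_erase.2 ⟨hne, hc⟩) hcT
      rw [← ht, ← hh]
      exact this
    · refine joins_single (X := X.mergeArc c k) (Finset.mem_erase.2 ⟨hek, he⟩) fun h => heT ?_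
      split_ifs
      · exact Finset.mem_insert_of_mem h
      · exact h
  · split_ifs with hcT
    · exact (hw' T hcT hkT).ge
    · exact (hw T hcT).ge
  · intro U hU
    by_cases hb : c ∈ U ∧ k ∈ U
    · refine ⟨U.erase k, hU.of_lift (Finset.erase_subset_erase _ hU.1) ?_, ?_⟩
      · intro e he heU
        obtain ⟨hek, he⟩ := Finset.mem_erase.1 he
        exact joins_single he fun h => heU (Finset.mem_erase.2 ⟨hek, h⟩)
      · rw [hw' _ (Finset.mem_erase.2 ⟨hne, hb.1⟩) (Finset.notMem_erase _ _),
          Finset.insert_erase hb.2]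
        exact le_rfl
    · refine ⟨(U.erase k).erase c, hU.of_lift ?_ ?_, ?_⟩
      · exact (Finset.erase_subset _ _).trans (Finset.erase_subset_erase _ hU.1)
      · intro e he heU
        obtain ⟨hek, he⟩ := Finset.mem_erase.1 he
        by_cases hec : e = c
        · subst hec
          by_cases heU' : e ∈ U
          · have := joins_single hk fun h => hb ⟨heU', h⟩
            rw [← ht, ← hh] at this
            exact this
          · exact joins_single hc heU'
        · exact joins_single he fun h =>
            heU (Finset.mem_erase.2 ⟨hec, Finset.mem_erase.2 ⟨hek, h⟩⟩)
      · rw [hw _ (Finset.notMem_erase _ _)]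
        exact Finset.sum_le_sum_of_subset
          ((Finset.erase_subset _ _).trans (Finset.erase_subset _ _))

/-- The arcs `e` and `f` lie on the same cycles, so a competitor that cuts either may cut the
lighter arc `l` instead, and `k` need never be cut. -/
theorem IsOptimalFAS.of_splice {X : WDigraph V E} {e f l k : E} {T : Finset E} (he : e ∈ X.arcs)
    (hf : f ∈ X.arcs) (hlk : l = e ∧ k = f ∨ l = f ∧ k = e) (hef : e ≠ f)
    (hv : X.head e = X.tail f) (hin : ∀ g ∈ X.arcs, X.head g = X.head e → g = e)
    (hout : ∀ g ∈ X.arcs, X.tail g = X.head e → g = f) (hle : X.weight l ≤ X.weight k)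
    (hT : (X.splice e f l k he hf).IsOptimalFAS T) : X.IsOptimalFAS T := by
  set Y := X.splice e f l k he hf with hY
  have hlne : l ≠ k := by
    rcases hlk with ⟨rfl, rfl⟩ | ⟨rfl, rfl⟩
    · exact hef
    · exact hef.symm
  have hla : l ∈ Y.arcs := by
    refine Finset.mem_erase.2 ⟨hlne, ?_⟩
    rcases hlk with ⟨rfl, rfl⟩ | ⟨rfl, rfl⟩ <;> assumption
  have htl : Y.tail l = X.tail e := Function.update_self ..
  have hhl : Y.head l = X.head f := Function.update_self ..
  have htg : ∀ g, g ≠ l → Y.tail g = X.tail g := fun g hg => Function.update_of_ne hg ..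
  have hhg : ∀ g, g ≠ l → Y.head g = X.head g := fun g hg => Function.update_of_ne hg ..
  have hmem : ∀ g, g = e ∨ g = f ↔ g = l ∨ g = k := by
    intro g
    rcases hlk with ⟨rfl, rfl⟩ | ⟨rfl, rfl⟩
    · exact Iff.rfl
    · exact or_comm
  refine hT.transfer 0 ⟨fun e he => Finset.mem_of_mem_erase (hT.1.1 he), ?_⟩ le_rfl ?_
  · refine Relation.acyclic_of_bypass (v := X.head e) ?_ ?_ ?_ hT.1.2
    · rintro _ _ ⟨g, ⟨hg, hgT⟩, rfl, rfl⟩ h1 h2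
      have hglk : ¬ (g = l ∨ g = k) := by
        rw [← hmem]
        rintro (rfl | rfl)
        · exact h2 rfl
        · exact h1 hv.symm
      simp only [not_or] at hglk
      exact ⟨g, ⟨Finset.mem_erase.2 ⟨hglk.2, hg⟩, hgT⟩, htg g hglk.1, hhg g hglk.1⟩
    · rintro _ _ ⟨g, ⟨hg, hgT⟩, rfl, hgv⟩ ⟨g', ⟨hg', hgT'⟩, hgv', rfl⟩
      obtain rfl := hin g hg hgv
      obtain rfl := hout g' hg' hgv'
      refine ⟨l, ⟨hla, ?_⟩, htl, hhl⟩
      rcases hlk with ⟨rfl, rfl⟩ | ⟨rfl, rfl⟩ <;> assumption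
    · rintro ⟨g, ⟨hg, -⟩, h1, h2⟩
      exact hef ((hin g hg h2).symm.trans (hout g hg h1))
  · intro U hU
    by_cases hb : e ∈ U ∨ f ∈ U
    · have hlU : l ∉ (U.erase e).erase f := by
        have := (hmem l).2 (Or.inl rfl)
        simp only [Finset.mem_erase, not_and]
        tauto
      refine ⟨insert l ((U.erase e).erase f), hU.of_lift ?_ ?_, ?_⟩
      · refine Finset.insert_subset hla fun g hg => ?_
        simp only [Finset.mem_erase] at hg
        refine Finset.mem_erase.2 ⟨?_, hU.1 hg.2.2⟩
        rintro rfl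
        have := (hmem g).2 (Or.inr rfl)
        tauto
      · intro g hg hgU
        obtain ⟨hgk, hg⟩ := Finset.mem_erase.1 hg
        have hgl : g ≠ l := by
          rintro rfl
          exact hgU (Finset.mem_insert_self _ _)
        have hge : ¬ (g = e ∨ g = f) := by
          rw [hmem]
          tauto
        rw [htg g hgl, hhg g hgl]
        refine joins_single hg fun h => hgU ?_
        simp only [Finset.mem_insert, Finset.mem_erase]
        tauto
      · have hsum : ∀ x, x = l ∨ x = k → x ∈ U → X.weight x + ∑ g ∈ (U.erase e).erase f, X.weight g ≤
            ∑ g ∈ U, X.weight g := by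
          intro x hx hxU
          have hx' : x ∉ (U.erase e).erase f := by
            have := (hmem x).2 hx
            simp only [Finset.mem_erase]
            tauto
          rw [← Finset.sum_insert hx']
          exact Finset.sum_le_sum_of_subset (Finset.insert_subset hxU
            ((Finset.erase_subset _ _).trans (Finset.erase_subset _ _)))
        rw [Finset.sum_insert hlU, add_zero]
        change X.weight l + ∑ g ∈ (U.erase e).erase f, X.weight g ≤ _
        obtain ⟨x, hx, hxU⟩ : ∃ x, (x = l ∨ x = k) ∧ x ∈ U := by
          rcases hb with hb | hb
          · exact ⟨e, (hmem e).1 (Or.inl rfl), hb⟩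
          · exact ⟨f, (hmem f).1 (Or.inr rfl), hb⟩
        have h1 := hsum x hx hxU
        rcases hx with rfl | rfl <;> omega
    · simp only [not_or] at hb
      have hk : k ∉ U := by
        rcases hlk with ⟨rfl, rfl⟩ | ⟨rfl, rfl⟩
        exacts [hb.2, hb.1]
      refine ⟨U, hU.of_lift ?_ ?_, le_rfl⟩
      · intro g hg
        refine Finset.mem_erase.2 ⟨?_, hU.1 hg⟩
        rintro rfl
        exact hk hg
      · intro g hg hgU
        obtain ⟨hgk, hg⟩ := Finset.mem_erase.1 hg
        by_cases hgl : g = l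
        · subst hgl
          rw [htl, hhl]
          have h1 := joins_single he hb.1
          have h2 := joins_single hf hb.2
          rw [← hv] at h2
          exact h1.trans h2
        · rw [htg g hgl, hhg g hgl]
          exact joins_single hg hgU

end WDigraph

/-! ### Running times and loop invariants -/

namespace Ram

@[simp] theorem State.setVar_var (s : State) (x k y : ℕ) :
    (s.setVar x k).var y = if y = x then k else s.var y := by
  simp [State.setVar, Function.update_apply]

@[simp] theorem State.setVar_arr (s : State) (x k : ℕ) : (s.setVar x k).arr = s.arr := rfl

@[simp] theorem State.setArr_var (s : State) (a i k : ℕ) : (s.setArr a i k).var = s.var := rfl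

@[simp] theorem State.setArr_arr (s : State) (a i k b j : ℕ) :
    (s.setArr a i k).arr b j = if b = a ∧ j = i then k else s.arr b j := by
  by_cases h : b = a
  · subst h
    simp [State.setArr, Function.update_apply]
  · simp [State.setArr, h]

/-- Whether the program assigns to the variable `y`. -/
def Cmd.writesVar (y : ℕ) : Cmd → Bool
  | skip => false
  | assign x _ => x == y
  | store _ _ _ => false
  | seq p q => p.writesVar y || q.writesVar y
  | ite _ p q => p.writesVar y || q.writesVar y
  | loop _ p => p.writesVar y

/-- Whether the program stores to the array `b`. -/
def Cmd.writesArr (b : ℕ) : Cmd → Bool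
  | skip => false
  | assign _ _ => false
  | store a _ _ => a == b
  | seq p q => p.writesArr b || q.writesArr b
  | ite _ p q => p.writesArr b || q.writesArr b
  | loop _ p => p.writesArr b

/-- `s'` agrees with `s` on the memory that `p` does not write to. -/
def Cmd.Frame (p : Cmd) (s s' : State) : Prop :=
  (∀ y, p.writesVar y = false → s'.var y = s.var y) ∧
    ∀ a, p.writesArr a = false → s'.arr a = s.arr a

theorem Cmd.Frame.refl (p : Cmd) (s : State) : p.Frame s s := ⟨fun _ _ => rfl, fun _ _ => rfl⟩

theorem Cmd.Frame.trans {p : Cmd} {s s' s'' : State} (h : p.Frame s s') (h' : p.Frame s' s'') :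
    p.Frame s s'' :=
  ⟨fun y hy => (h'.1 y hy).trans (h.1 y hy), fun a ha => (h'.2 a ha).trans (h.2 a ha)⟩

/-- Whether a concrete program writes to a cell is decided by evaluation, so unchanged memory is
mostly settled by `rfl` and invariants mention only what a loop alters. -/
theorem Exec.frame {p : Cmd} {s s' : State} {t : ℕ} (h : Exec p s t s') : p.Frame s s' := by
  induction h with
  | skip s => exact .refl _ _
  | assign s x e =>
    refine ⟨fun y hy => ?_, fun _ _ => rfl⟩
    simp only [Cmd.writesVar, beq_eq_false_iff_ne] at hy
    simp [hy.symm]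
  | store s a i e =>
    refine ⟨fun _ _ => rfl, fun b hb => ?_⟩
    simp only [Cmd.writesArr, beq_eq_false_iff_ne] at hb
    funext j
    simp [hb.symm]
  | seq _ _ ih1 ih2 =>
    refine ⟨fun y hy => ?_, fun a ha => ?_⟩
    · simp only [Cmd.writesVar, Bool.or_eq_false_iff] at hy
      rw [ih2.1 y hy.2, ih1.1 y hy.1]
    · simp only [Cmd.writesArr, Bool.or_eq_false_iff] at ha
      rw [ih2.2 a ha.2, ih1.2 a ha.1]
  | ite_true _ _ ih =>
    refine ⟨fun y hy => ih.1 y ?_, fun a ha => ih.2 a ?_⟩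
    · simp only [Cmd.writesVar, Bool.or_eq_false_iff] at hy
      exact hy.1
    · simp only [Cmd.writesArr, Bool.or_eq_false_iff] at ha
      exact ha.1
  | ite_false _ _ ih =>
    refine ⟨fun y hy => ih.1 y ?_, fun a ha => ih.2 a ?_⟩
    · simp only [Cmd.writesVar, Bool.or_eq_false_iff] at hy
      exact hy.2
    · simp only [Cmd.writesArr, Bool.or_eq_false_iff] at ha
      exact ha.2
  | loop_true _ _ _ ih1 ih2 => exact Cmd.Frame.trans ih1 ih2
  | loop_false _ => exact .refl _ _

/-- Started in `s`, the program `p` halts after at most `t` steps in a state satisfying `Q`. -/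
def Runs (p : Cmd) (s : State) (t : ℕ) (Q : State → Prop) : Prop :=
  ∃ t' s', Exec p s t' s' ∧ t' ≤ t ∧ Q s'

theorem Runs.mono {p : Cmd} {s : State} {t t' : ℕ} {Q Q' : State → Prop} (h : Runs p s t Q)
    (ht : t ≤ t') (hQ : ∀ s', p.Frame s s' → Q s' → Q' s') : Runs p s t' Q' := by
  obtain ⟨t₁, s', h1, h2, h3⟩ := h
  exact ⟨t₁, s', h1, h2.trans ht, hQ s' h1.frame h3⟩

theorem Runs.seq {p q : Cmd} {s : State} {t₁ t₂ : ℕ} {Q Q' : State → Prop} (h : Runs p s t₁ Q)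
    (h' : ∀ s', p.Frame s s' → Q s' → Runs q s' t₂ Q') : Runs (.seq p q) s (t₁ + t₂) Q' := by
  obtain ⟨t, s₁, h1, h2, h3⟩ := h
  obtain ⟨t', s₂, h4, h5, h6⟩ := h' s₁ h1.frame h3
  exact ⟨_, s₂, .seq h1 h4, Nat.add_le_add h2 h5, h6⟩

theorem Runs.assign {s : State} {x : ℕ} {e : Expr} {Q : State → Prop}
    (h : Q (s.setVar x (e.eval s))) : Runs (.assign x e) s (e.cost + 1) Q :=
  ⟨_, _, .assign s x e, le_rfl, h⟩

theorem Runs.ite {b : Expr} {p q : Cmd} {s : State} {t : ℕ} {Q : State → Prop}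
    (h1 : b.eval s ≠ 0 → Runs p s t Q) (h2 : b.eval s = 0 → Runs q s t Q) :
    Runs (.ite b p q) s (b.cost + 1 + t) Q := by
  by_cases h : b.eval s = 0
  · obtain ⟨t, s', h3, h4, h5⟩ := h2 h
    exact ⟨_, s', .ite_false h h3, Nat.add_le_add_left h4 _, h5⟩
  · obtain ⟨t, s', h3, h4, h5⟩ := h1 h
    exact ⟨_, s', .ite_true h h3, Nat.add_le_add_left h4 _, h5⟩

/-- Programs without loops. -/
def Cmd.straight : Cmd → Bool
  | skip => true
  | assign _ _ => true
  | store _ _ _ => true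
  | seq p q => p.straight && q.straight
  | ite _ p q => p.straight && q.straight
  | loop _ _ => false

/-- The final state of a program without loops. -/
def Cmd.run : Cmd → State → State
  | skip, s => s
  | assign x e, s => s.setVar x (e.eval s)
  | store a i e, s => s.setArr a (i.eval s) (e.eval s)
  | seq p q, s => q.run (p.run s)
  | ite b p q, s => if b.eval s = 0 then q.run s else p.run s
  | loop _ _, s => s

/-- A bound on the number of steps of a program without loops. -/
def Cmd.bound : Cmd → ℕ
  | skip => 1
  | assign _ e => e.cost + 1
  | store _ i e => i.cost + e.cost + 1
  | seq p q => p.bound + q.bound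
  | ite b p q => b.cost + 1 + (p.bound + q.bound)
  | loop _ _ => 0

theorem Runs.of_straight (p : Cmd) (hp : p.straight = true) (s : State) {Q : State → Prop}
    (h : Q (p.run s)) : Runs p s p.bound Q := by
  suffices ∃ t, Exec p s t (p.run s) ∧ t ≤ p.bound by
    obtain ⟨t, h1, h2⟩ := this
    exact ⟨t, _, h1, h2, h⟩
  clear h
  induction p generalizing s with
  | skip => exact ⟨_, .skip s, le_rfl⟩
  | assign x e => exact ⟨_, .assign s x e, le_rfl⟩
  | store a i e => exact ⟨_, .store s a i e, le_rfl⟩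
  | seq p q ihp ihq =>
    simp only [Cmd.straight, Bool.and_eq_true] at hp
    obtain ⟨t1, h1, h1'⟩ := ihp hp.1 s
    obtain ⟨t2, h2, h2'⟩ := ihq hp.2 (p.run s)
    exact ⟨_, .seq h1 h2, Nat.add_le_add h1' h2'⟩
  | ite b p q ihp ihq =>
    simp only [Cmd.straight, Bool.and_eq_true] at hp
    simp only [Cmd.run, Cmd.bound]
    split_ifs with hb
    · obtain ⟨t, h1, h2⟩ := ihq hp.2 s
      exact ⟨_, .ite_false hb h1, by omega⟩
    · obtain ⟨t, h1, h2⟩ := ihp hp.1 s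
      exact ⟨_, .ite_true hb h1, by omega⟩
  | loop => simp [Cmd.straight] at hp

/-- `for x = 0, …, b - 1 do body`. -/
def forLoop (x b : ℕ) (body : Cmd) : Cmd :=
  .seq (.assign x (.lit 0)) (.loop (.sub (.var b) (.var x))
    (.seq body (.assign x (.add (.var x) (.lit 1)))))

/-- An iteration costs at most `c`, plus 4 for the test and 4 for the increment. The initial
assignment costs 2 and the final test 4. -/
theorem Runs.forLoop {x b N c : ℕ} {body : Cmd} (I : ℕ → State → Prop) (s : State)
    (hN : s.var b = N) (hxb : x ≠ b) (hx : body.writesVar x = false)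
    (hb : body.writesVar b = false) (h0 : I 0 (s.setVar x 0))
    (hstep : ∀ i < N, ∀ s', (Ram.forLoop x b body).Frame s s' → s'.var x = i → I i s' →
      Runs body s' c fun s'' => I (i + 1) (s''.setVar x (i + 1))) :
    Runs (Ram.forLoop x b body) s ((N + 1) * (c + 10)) (I N) := by
  have hwb : (Ram.forLoop x b body).writesVar b = false := by
    simp [Ram.forLoop, Cmd.writesVar, hb, hxb]
  have key : ∀ j i, i + j = N → ∀ s', (Ram.forLoop x b body).Frame s s' → s'.var x = i → I i s' →
      Runs (.loop (.sub (.var b) (.var x)) (.seq body (.assign x (.add (.var x) (.lit 1))))) s'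
        (j * (c + 8) + 4) (I N) := by
    intro j
    induction j with
    | zero =>
      intro i hi s' hs hxi hI
      obtain rfl : i = N := by omega
      refine ⟨_, s', .loop_false ?_, ?_, hI⟩
      · simp [Expr.eval, hxi, hs.1 b hwb, hN]
      · simp [Expr.cost]
    | succ j ih =>
      intro i hi s' hs hxi hI
      obtain ⟨t, s₁, h1, h2, h3⟩ := hstep i (by omega) s' hs hxi hI
      have hx1 : s₁.var x = i := by rw [h1.frame.1 x hx, hxi]
      have hset : s₁.setVar x (i + 1) =
          s₁.setVar x ((Expr.add (.var x) (.lit 1)).eval s₁) := by simp [Expr.eval, hx1]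
      have hfr : (Ram.forLoop x b body).Frame s (s₁.setVar x (i + 1)) := by
        refine hs.trans ⟨fun y hy => ?_, fun a ha => ?_⟩
        · simp only [Ram.forLoop, Cmd.writesVar, Bool.or_eq_false_iff, beq_eq_false_iff_ne] at hy
          simp [h1.frame.1 y hy.2.1, hy.1.symm]
        · simp only [Ram.forLoop, Cmd.writesArr, Bool.or_eq_false_iff] at ha
          simp [h1.frame.2 a ha.2.1]
      obtain ⟨t', s₂, h4, h5, h6⟩ := ih (i + 1) (by omega) _ hfr (by simp) h3
      rw [hset] at h4
      refine ⟨_, s₂, .loop_true ?_ (.seq h1 (.assign _ _ _)) h4, ?_, h6⟩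
      · simp only [Expr.eval, hxi, hs.1 b hwb, hN]
        omega
      · simp only [Expr.cost, add_mul, one_mul]
        omega
  obtain ⟨t, s', h1, h2, h3⟩ := key N 0 (by omega) (s.setVar x 0)
    ⟨fun y hy => by
      simp only [Ram.forLoop, Cmd.writesVar, Bool.or_eq_false_iff, beq_eq_false_iff_ne] at hy
      simp [hy.1.symm], fun _ _ => rfl⟩ (by simp) h0
  refine ⟨_, s', .seq (.assign _ _ _) h1, ?_, h3⟩
  simp only [Expr.cost]
  nlinarith

theorem Runs.forLoop_straight {x b N : ℕ} {body : Cmd} (I : ℕ → State → Prop) (s : State)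
    (hN : s.var b = N) (hp : body.straight = true) (hxb : x ≠ b)
    (hx : body.writesVar x = false) (hb : body.writesVar b = false) (h0 : I 0 (s.setVar x 0))
    (hstep : ∀ i < N, ∀ s', (Ram.forLoop x b body).Frame s s' → s'.var x = i → I i s' →
      I (i + 1) ((body.run s').setVar x (i + 1))) :
    Runs (Ram.forLoop x b body) s ((N + 1) * (body.bound + 10)) (I N) :=
  .forLoop I s hN hxb hx hb h0 fun i hi s' hs hxi hI =>
    .of_straight _ hp _ (hstep i hi s' hs hxi hI)

namespace Expr

/-- Nonzero if and only if `p` and `q` differ. -/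
def ne (p q : Expr) : Expr := .add (.sub p q) (.sub q p)

/-- Nonzero if and only if `p` is zero. -/
def not (p : Expr) : Expr := .sub (.lit 1) p

@[simp] theorem eval_lit (s : State) (k : ℕ) : (lit k).eval s = k := rfl
@[simp] theorem eval_var (s : State) (x : ℕ) : (var x).eval s = s.var x := rfl
@[simp] theorem eval_get (s : State) (a : ℕ) (i : Expr) : (get a i).eval s = s.arr a (i.eval s) :=
  rfl
@[simp] theorem eval_add (s : State) (p q : Expr) : (add p q).eval s = p.eval s + q.eval s := rfl
@[simp] theorem eval_sub (s : State) (p q : Expr) : (sub p q).eval s = p.eval s - q.eval s := rfl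

theorem eval_ne (s : State) (p q : Expr) : (ne p q).eval s = 0 ↔ p.eval s = q.eval s := by
  simp only [ne, eval_add, eval_sub]
  omega

theorem eval_not (s : State) (p : Expr) : (not p).eval s = 0 ↔ p.eval s ≠ 0 := by
  simp only [not, eval_sub, eval_lit]
  omega

end Expr

end Ram

/-! ### Invariants relating memory and graph -/

namespace Ram

open WDigraph

variable {n m : ℕ}

/-- The arrays `0`, `1`, `2` hold the tails, heads and weights of `X`, and the arcs of `X` are the
fixed points of array `5`. -/
structure Rep (X : WDigraph (Fin n) (Fin m)) (A : ℕ → ℕ → ℕ) : Prop where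
  tail : ∀ e : Fin m, A 0 e = X.tail e
  head : ∀ e : Fin m, A 1 e = X.head e
  weight : ∀ e : Fin m, A 2 e = X.weight e
  alive : ∀ e : Fin m, A 5 e = e ↔ e ∈ X.arcs

/-- The label `y` is that of an arc of `T`, or `m + 1`. -/
def Sel (T : Finset (Fin m)) (y : ℕ) : Prop := y = m + 1 ∨ ∃ e ∈ T, (e : ℕ) = y

/-- The forwarding pointers `F` turn optimal feedback arc sets of `X` into such sets of `G`. -/
structure Lift (G X : WDigraph (Fin n) (Fin m)) (F : ℕ → ℕ) : Prop where
  discard : F m = m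
  keep : F (m + 1) = m + 1
  lift : ∃ d, d + X.arcs.card ≤ m ∧ (∀ x < m, F (F^[d] x) = F^[d] x) ∧
    ∀ T, X.IsOptimalFAS T → ∀ U : Finset (Fin m), (∀ x : Fin m, x ∈ U ↔ Sel T (F^[d] x)) →
      G.IsOptimalFAS U

theorem Lift.refl (G : WDigraph (Fin n) (Fin m)) {F : ℕ → ℕ} (hF : ∀ x < m + 2, F x = x) :
    Lift G G F := by
  refine ⟨hF _ (by omega), hF _ (by omega), 0, ?_, fun x hx => hF _ (by simp; omega), ?_⟩
  · simpa using Finset.card_le_univ G.arcs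
  · intro T hT U hU
    have : U = T := by
      ext x
      rw [hU]
      simp only [Function.iterate_zero, id, Sel]
      constructor
      · rintro (h | ⟨e, he, h⟩)
        · have := x.2
          omega
        · rwa [← Fin.ext h]
      · exact fun h => Or.inr ⟨x, h, rfl⟩
    rwa [this]

/-- Redirecting `k` to a root `z` makes every arc that ended at `k` share the fate of `z`. With `z =
m` these arcs are never cut, with `z = m + 1` always, and with a living arc exactly when it is. -/
theorem Lift.kill {G X X' : WDigraph (Fin n) (Fin m)} {F F' : ℕ → ℕ} {k : Fin m} {z : ℕ}
    (hL : Lift G X F) (hk : k ∈ X.arcs) (hFk : F k = k) (harcs : X'.arcs = X.arcs.erase k)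
    (hz : z ≠ k) (hFz : F z = z) (h5 : ∀ j, F' j = if j = k then z else F j)
    (hT : ∀ T, X'.IsOptimalFAS T →
      (Sel T z → X.IsOptimalFAS (insert k T)) ∧ (¬ Sel T z → X.IsOptimalFAS T)) :
    Lift G X' F' := by
  have hkm := k.2
  obtain ⟨hm, hm1, d, hd, hfix, hlift⟩ := hL
  have hz' : F' z = z := by rw [h5, if_neg hz, hFz]
  -- The new pointer path agrees with the old one until that has come to rest at `k`; from there it
  -- moves to `z` and stays.
  have key : ∀ x j, F'^[j] x = F^[j] x ∨ F^[j] x = k ∧ F'^[j] x = z := by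
    intro x j
    induction j with
    | zero => exact Or.inl rfl
    | succ j ih =>
      rw [Function.iterate_succ_apply', Function.iterate_succ_apply']
      rcases ih with ih | ⟨ih1, ih2⟩
      · rw [ih, h5]
        split_ifs with h
        · exact Or.inr ⟨by rw [h, hFk], rfl⟩
        · exact Or.inl rfl
      · rw [ih1, ih2, hz', hFk]
        exact Or.inr ⟨rfl, rfl⟩
  have key' : ∀ x < m, F'^[d + 1] x = if F^[d] x = k then z else F^[d] x := by
    intro x hx
    rw [Function.iterate_succ_apply']
    rcases key x d with h | ⟨h1, h2⟩
    · rw [h, h5, hfix x hx]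
    · rw [h2, hz', if_pos h1]
  -- Paths grow by at most one step while one arc disappears, so `d + X.arcs.card ≤ m` persists. In
  -- the end `m` steps always reach the root.
  refine ⟨?_, ?_, d + 1, ?_, ?_, ?_⟩
  · rw [h5, if_neg (by omega), hm]
  · rw [h5, if_neg (by omega), hm1]
  · rw [harcs, Finset.card_erase_of_mem hk]
    have := Finset.card_pos.2 ⟨k, hk⟩
    omega
  · intro x hx
    rw [key' x hx]
    split_ifs with h
    · exact hz'
    · rw [h5, if_neg h, hfix x hx]
  · intro T hTo U hU
    obtain ⟨hT1, hT2⟩ := hT T hTo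
    have hkT : k ∉ T := by
      intro h
      have := hTo.1.1 h
      rw [harcs] at this
      exact Finset.notMem_erase _ _ this
    by_cases hs : Sel T z
    · refine hlift _ (hT1 hs) U fun x => ?_
      rw [hU, key' x x.2]
      split_ifs with h
      · simp only [hs, true_iff]
        exact Or.inr ⟨k, Finset.mem_insert_self _ _, h.symm⟩
      · refine or_congr_right ⟨fun ⟨e, he, h'⟩ => ⟨e, Finset.mem_insert_of_mem he, h'⟩, ?_⟩
        rintro ⟨e, he, h'⟩
        rcases Finset.mem_insert.1 he with rfl | he
        · exact absurd h'.symm h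
        · exact ⟨e, he, h'⟩
    · refine hlift _ (hT2 hs) U fun x => ?_
      rw [hU, key' x x.2]
      split_ifs with h
      · simp only [hs, false_iff]
        rw [h]
        rintro (h' | ⟨e, he, h'⟩)
        · omega
        · exact hkT (Fin.ext h' ▸ he)
      · exact Iff.rfl

theorem Rep.kill {X X' : WDigraph (Fin n) (Fin m)} {A A' : ℕ → ℕ → ℕ} {k : Fin m} {z : ℕ}
    (hX : Rep X A) (harcs : X'.arcs = X.arcs.erase k)
    (hz : z ≠ k) (h0 : ∀ e : Fin m, A' 0 e = X'.tail e) (h1 : ∀ e : Fin m, A' 1 e = X'.head e)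
    (h2 : ∀ e : Fin m, A' 2 e = X'.weight e) (h5 : ∀ j, A' 5 j = if j = k then z else A 5 j) :
    Rep X' A' := by
  refine ⟨h0, h1, h2, fun e => ?_⟩
  rw [h5, harcs, Finset.mem_erase, ← hX.alive]
  split_ifs with h
  · have : e = k := Fin.ext h
    subst this
    simp [hz]
  · have : e ≠ k := fun h' => h (h' ▸ rfl)
    simp [this]

/-- Arcs at vertices outside `S` are found by the pointers in the arrays `7` and `8`. -/
def Ptr (S : Finset (Fin n)) (X : WDigraph (Fin n) (Fin m)) (A : ℕ → ℕ → ℕ) : Prop :=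
  ∀ e ∈ X.arcs, (X.head e ∉ S → A 7 (X.head e) = e) ∧ (X.tail e ∉ S → A 8 (X.tail e) = e)

/-- The vertices of `X` outside `S` and less than `i` have been eliminated from `X₀`. -/
def Elim (G X₀ : WDigraph (Fin n) (Fin m)) (S : Finset (Fin n)) (i : ℕ) (A : ℕ → ℕ → ℕ) : Prop :=
  ∃ X : WDigraph (Fin n) (Fin m), Rep X A ∧ Lift G X (A 5) ∧ Ptr S X A ∧
    (∀ e ∈ X.arcs, (X.head e ∉ S → i ≤ X.head e) ∧ (X.tail e ∉ S → i ≤ X.tail e)) ∧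
    (∀ u ∈ S, ∀ t, X.gmat S u t = X₀.gmat S u t) ∧ (X = X₀ ∨ X.arcs.card < X₀.arcs.card)

/-! ### Eliminating one vertex -/

section Branches

variable {G X₀ : WDigraph (Fin n) (Fin m)} {S : Finset (Fin n)} {v : Fin n} {A A' : ℕ → ℕ → ℕ}

/-- The array `b` points to an arc with end `v`, the ends being in the array `a`. -/
def Hit (m a b v : ℕ) (A : ℕ → ℕ → ℕ) : Prop :=
  A b v < m ∧ A 5 (A b v) = A b v ∧ A a (A b v) = v

theorem card_lt_of_erase {X X' X₀ : WDigraph (Fin n) (Fin m)} {k : Fin m} (hk : k ∈ X.arcs)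
    (harcs : X'.arcs = X.arcs.erase k) (h : X = X₀ ∨ X.arcs.card < X₀.arcs.card) :
    X'.arcs.card < X₀.arcs.card := by
  rw [harcs, Finset.card_erase_of_mem hk]
  have := Finset.card_pos.2 ⟨k, hk⟩
  rcases h with rfl | h <;> omega

/-- A pointer may be stale, so it is tested before use. Under `Ptr` any arc entering `v` is the one
pointed to, which gives uniqueness; a failed test shows that there is none. -/
theorem Rep.hit_head {X : WDigraph (Fin n) (Fin m)} (hX : Rep X A) (hP : Ptr S X A) (hv : v ∉ S)
    (h : Hit m 1 7 v A) : ∃ e ∈ X.arcs, A 7 v = e ∧ X.head e = v ∧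
      ∀ g ∈ X.arcs, X.head g = v → g = e := by
  obtain ⟨h1, h2, h3⟩ := h
  refine ⟨⟨_, h1⟩, (hX.alive _).1 h2, rfl, Fin.ext ?_, ?_⟩
  · rw [← hX.head, h3]
  · rintro g hg rfl
    exact Fin.ext ((hP g hg).1 hv).symm

theorem Rep.hit_tail {X : WDigraph (Fin n) (Fin m)} (hX : Rep X A) (hP : Ptr S X A) (hv : v ∉ S)
    (h : Hit m 0 8 v A) : ∃ e ∈ X.arcs, A 8 v = e ∧ X.tail e = v ∧
      ∀ g ∈ X.arcs, X.tail g = v → g = e := by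
  obtain ⟨h1, h2, h3⟩ := h
  refine ⟨⟨_, h1⟩, (hX.alive _).1 h2, rfl, Fin.ext ?_, ?_⟩
  · rw [← hX.tail, h3]
  · rintro g hg rfl
    exact Fin.ext ((hP g hg).2 hv).symm

theorem Rep.not_hit_head {X : WDigraph (Fin n) (Fin m)} (hX : Rep X A) (hP : Ptr S X A)
    (hv : v ∉ S) (h : ¬ Hit m 1 7 v A) : ∀ g ∈ X.arcs, X.head g ≠ v := by
  rintro g hg rfl
  refine h ?_
  rw [Hit, (hP g hg).1 hv]
  exact ⟨g.2, (hX.alive g).2 hg, hX.head g⟩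

theorem Rep.not_hit_tail {X : WDigraph (Fin n) (Fin m)} (hX : Rep X A) (hP : Ptr S X A)
    (hv : v ∉ S) (h : ¬ Hit m 0 8 v A) : ∀ g ∈ X.arcs, X.tail g ≠ v := by
  rintro g hg rfl
  refine h ?_
  rw [Hit, (hP g hg).2 hv]
  exact ⟨g.2, (hX.alive g).2 hg, hX.tail g⟩

theorem succ_le_of_ne {i : ℕ} {x v : Fin n} (hv : (v : ℕ) = i) (h : i ≤ x) (hne : x ≠ v) :
    i + 1 ≤ x := by
  have : (x : ℕ) ≠ v := fun h => hne (Fin.ext h)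
  omega

theorem Elim.of_mem (h : Elim G X₀ S v A) (hv : v ∈ S) : Elim G X₀ S (v + 1) A := by
  obtain ⟨X, hX, hL, hP, hE, hg, hc⟩ := h
  refine ⟨X, hX, hL, hP, fun e he => ⟨fun hS => ?_, fun hS => ?_⟩, hg, hc⟩
  · exact succ_le_of_ne rfl ((hE e he).1 hS) (by rintro rfl; exact hS hv)
  · exact succ_le_of_ne rfl ((hE e he).2 hS) (by rintro rfl; exact hS hv)

theorem Elim.of_not_hit (h : Elim G X₀ S v A) (hv : v ∉ S) (h1 : ¬ Hit m 1 7 v A)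
    (h0 : ¬ Hit m 0 8 v A) : Elim G X₀ S (v + 1) A := by
  obtain ⟨X, hX, hL, hP, hE, hg, hc⟩ := h
  refine ⟨X, hX, hL, hP, fun e he => ⟨fun hS => ?_, fun hS => ?_⟩, hg, hc⟩
  · exact succ_le_of_ne rfl ((hE e he).1 hS) (hX.not_hit_head hP hv h1 e he)
  · exact succ_le_of_ne rfl ((hE e he).2 hS) (hX.not_hit_tail hP hv h0 e he)

/-- No arc has the label `m`, so `Sel T m` never holds. -/
theorem not_sel_discard {k : Fin m} {X : WDigraph (Fin n) (Fin m)} {T : Finset (Fin m)}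
    (h : (X.dropArc k).IsOptimalFAS T → X.IsOptimalFAS T) (hT : (X.dropArc k).IsOptimalFAS T) :
    (Sel T m → X.IsOptimalFAS (insert k T)) ∧ (¬ Sel T m → X.IsOptimalFAS T) := by
  refine ⟨?_, fun _ => h hT⟩
  rintro (h' | ⟨e, -, h'⟩)
  · omega
  · have := e.2
    omega

theorem Elim.of_drop {X : WDigraph (Fin n) (Fin m)} {k : Fin m} {z : ℕ} (hX : Rep X A)
    (hL : Lift G X (A 5)) (hP : Ptr S X A)
    (hE : ∀ e ∈ X.arcs, (X.head e ∉ S → v ≤ X.head e) ∧ (X.tail e ∉ S → v ≤ X.tail e))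
    (hc : X = X₀ ∨ X.arcs.card < X₀.arcs.card) (hk : k ∈ X.arcs)
    (hkh : ∀ g ∈ X.arcs, X.head g = v → g = k) (hkt : ∀ g ∈ X.arcs, X.tail g = v → g = k)
    (hg : ∀ u ∈ S, ∀ t, (X.dropArc k).gmat S u t = X₀.gmat S u t) (hz : z ≠ k)
    (hFz : A 5 z = z) (h5 : ∀ j, A' 5 j = if j = k then z else A 5 j)
    (hA : ∀ a, a ≠ 5 → A' a = A a)
    (hT : ∀ T, (X.dropArc k).IsOptimalFAS T →
      (Sel T z → X.IsOptimalFAS (insert k T)) ∧ (¬ Sel T z → X.IsOptimalFAS T)) :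
    Elim G X₀ S (v + 1) A' := by
  refine ⟨X.dropArc k, hX.kill rfl hz ?_ ?_ ?_ h5, hL.kill hk ((hX.alive k).2 hk) rfl hz hFz h5 hT,
    ?_, ?_, hg, Or.inr (card_lt_of_erase hk rfl hc)⟩
  · rw [hA _ (by decide)]
    exact hX.tail
  · rw [hA _ (by decide)]
    exact hX.head
  · rw [hA _ (by decide)]
    exact hX.weight
  · rw [Ptr, hA _ (by decide), hA _ (by decide)]
    exact fun e he => hP e (Finset.mem_of_mem_erase he)
  · intro e he
    obtain ⟨hek, he⟩ := Finset.mem_erase.1 he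
    refine ⟨fun hS => ?_, fun hS => ?_⟩
    · exact succ_le_of_ne rfl ((hE e he).1 hS) fun h => hek (hkh e he h)
    · exact succ_le_of_ne rfl ((hE e he).2 hS) fun h => hek (hkt e he h)

/-- The vertex `v` is a sink outside `S`, so no walk starting with its entering arc ever reaches
`S`. -/
theorem Elim.of_hit_head (h : Elim G X₀ S v A) (hv : v ∉ S) (h1 : Hit m 1 7 v A)
    (h0 : ¬ Hit m 0 8 v A) (h5 : ∀ j, A' 5 j = if j = A 7 v then m else A 5 j)
    (hA : ∀ a, a ≠ 5 → A' a = A a) : Elim G X₀ S (v + 1) A' := by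
  obtain ⟨X, hX, hL, hP, hE, hg, hc⟩ := h
  obtain ⟨k, hk, hAk, hkv, huniq⟩ := hX.hit_head hP hv h1
  have hout := hX.not_hit_tail hP hv h0
  have hkm := k.2
  rw [hAk] at h5
  have hnw : ∀ t w, ¬ X.Walk S k t w := by
    intro t w h
    cases h with
    | last _ _ h => exact hv (hkv ▸ h)
    | cons _ f _ _ _ hf h => exact hout f hf (h.symm.trans hkv)
  refine .of_drop hX hL hP hE hc hk huniq (fun g hg h => absurd h (hout g hg)) ?_ (by omega)
    hL.discard h5 hA fun T hT => not_sel_discard (.of_dropArc (Or.inr ?_)) hT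
  · intro u hu t
    rw [gmat_dropArc (Or.inr hnw) (Or.inr hnw) hu, hg u hu]
  · rwa [hkv]

/-- The vertex `v` is a source outside `S`: its leaving arc follows no other arc and starts no walk
counted in a row of `S`. -/
theorem Elim.of_hit_tail (h : Elim G X₀ S v A) (hv : v ∉ S) (h1 : ¬ Hit m 1 7 v A)
    (h0 : Hit m 0 8 v A) (h5 : ∀ j, A' 5 j = if j = A 8 v then m else A 5 j)
    (hA : ∀ a, a ≠ 5 → A' a = A a) : Elim G X₀ S (v + 1) A' := by
  obtain ⟨X, hX, hL, hP, hE, hg, hc⟩ := h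
  obtain ⟨k, hk, hAk, hkv, huniq⟩ := hX.hit_tail hP hv h0
  have hin := hX.not_hit_head hP hv h1
  have hkm := k.2
  rw [hAk] at h5
  refine .of_drop hX hL hP hE hc hk (fun g hg h => absurd h (hin g hg)) huniq ?_ (by omega)
    hL.discard h5 hA fun T hT => not_sel_discard (.of_dropArc (Or.inl ?_)) hT
  · intro u hu t
    rw [gmat_dropArc (Or.inl ?_) (Or.inl ?_) hu, hg u hu]
    · rw [hkv]
      exact fun g hg _ => hin g hg
    · rwa [hkv]
  · rwa [hkv]

/-- The only arc at `v` is a loop. It can be reached from no other arc, and it must be cut, hence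
the pointer to `m + 1`. -/
theorem Elim.of_loop (h : Elim G X₀ S v A) (hv : v ∉ S) (h1 : Hit m 1 7 v A)
    (h0 : Hit m 0 8 v A) (heq : A 7 v = A 8 v)
    (h5 : ∀ j, A' 5 j = if j = A 7 v then m + 1 else A 5 j)
    (hA : ∀ a, a ≠ 5 → A' a = A a) : Elim G X₀ S (v + 1) A' := by
  obtain ⟨X, hX, hL, hP, hE, hg, hc⟩ := h
  obtain ⟨k, hk, hAk, hkv, huniq⟩ := hX.hit_head hP hv h1
  obtain ⟨k', hk', hAk', hkv', huniq'⟩ := hX.hit_tail hP hv h0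
  obtain rfl : k = k' := Fin.ext (by rw [← hAk, ← hAk', heq])
  have hkm := k.2
  rw [hAk] at h5
  refine .of_drop hX hL hP hE hc hk huniq huniq' ?_ (by omega)
    hL.keep h5 hA fun T hT => ⟨fun _ => hT.of_dropArc_loop hk (hkv.trans hkv'.symm), fun h =>
      absurd (Or.inl rfl) h⟩
  intro u hu t
  rw [gmat_dropArc (Or.inl ?_) (Or.inl ?_) hu, hg u hu]
  · rw [hkv']
    exact fun g hg hne h => hne (huniq g hg h)
  · rwa [hkv']

theorem Elim.of_splice {X : WDigraph (Fin n) (Fin m)} {e f l k : Fin m} (hX : Rep X A)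
    (hL : Lift G X (A 5)) (hv : v ∉ S)
    (hE : ∀ e ∈ X.arcs, (X.head e ∉ S → v ≤ X.head e) ∧ (X.tail e ∉ S → v ≤ X.tail e))
    (hg : ∀ u ∈ S, ∀ t, X.gmat S u t = X₀.gmat S u t)
    (hc : X = X₀ ∨ X.arcs.card < X₀.arcs.card) (he : e ∈ X.arcs) (hf : f ∈ X.arcs)
    (hev : X.head e = v) (hfv : X.tail f = v) (hin : ∀ g ∈ X.arcs, X.head g = v → g = e)
    (hout : ∀ g ∈ X.arcs, X.tail g = v → g = f) (hef : e ≠ f)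
    (hlk : l = e ∧ k = f ∨ l = f ∧ k = e) (hle : X.weight l ≤ X.weight k)
    (h0 : ∀ j, A' 0 j = if j = l then ↑(X.tail e) else A 0 j)
    (h1 : ∀ j, A' 1 j = if j = l then ↑(X.head f) else A 1 j)
    (h2 : A' 2 = A 2) (h5 : ∀ j, A' 5 j = if j = k then m else A 5 j)
    (hP : Ptr S (X.splice e f l k he hf) A') : Elim G X₀ S (v + 1) A' := by
  have hkm := k.2
  have hk : k ∈ X.arcs := by
    rcases hlk with ⟨rfl, rfl⟩ | ⟨rfl, rfl⟩ <;> assumption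
  have hrest : ∀ g, g ≠ l → g ≠ k → g ≠ e ∧ g ≠ f := by
    rcases hlk with ⟨rfl, rfl⟩ | ⟨rfl, rfl⟩
    · exact fun g h1 h2 => ⟨h1, h2⟩
    · exact fun g h1 h2 => ⟨h2, h1⟩
  refine ⟨X.splice e f l k he hf, hX.kill rfl (z := m) (by omega) ?_ ?_ ?_ h5,
    hL.kill hk ((hX.alive k).2 hk) rfl (by omega) hL.discard h5 ?_, hP, ?_, ?_,
    Or.inr (card_lt_of_erase hk rfl hc)⟩
  · intro g
    rw [h0]
    simp only [splice, Function.update_apply, Fin.ext_iff, hX.tail]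
    split_ifs <;> rfl
  · intro g
    rw [h1]
    simp only [splice, Function.update_apply, Fin.ext_iff, hX.head]
    split_ifs <;> rfl
  · rw [h2]
    exact hX.weight
  · intro T hT
    refine ⟨?_, fun _ => ?_⟩
    · rintro (h' | ⟨e, -, h'⟩)
      · omega
      · have := e.2
        omega
    · refine hT.of_splice he hf hlk hef (hev.trans hfv.symm) ?_ ?_ hle
      · rwa [hev]
      · rwa [hev]
  · intro g hg
    obtain ⟨hgk, hg⟩ := Finset.mem_erase.1 hg
    simp only [splice, Function.update_apply]
    by_cases hgl : g = l
    · simp only [hgl, if_true]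
      refine ⟨fun hS => ?_, fun hS => ?_⟩
      · exact succ_le_of_ne rfl ((hE f hf).1 hS) fun h => hef (hin f hf h).symm
      · exact succ_le_of_ne rfl ((hE e he).2 hS) fun h => hef (hout e he h)
    · obtain ⟨h3, h4⟩ := hrest g hgl hgk
      simp only [hgl, if_false]
      refine ⟨fun hS => ?_, fun hS => ?_⟩
      · exact succ_le_of_ne rfl ((hE g hg).1 hS) fun h => h3 (hin g hg h)
      · exact succ_le_of_ne rfl ((hE g hg).2 hS) fun h => h4 (hout g hg h)
  · intro u hu t
    rw [gmat_splice he hf hlk hef (hev.trans hfv.symm) (hev ▸ hv) ?_ ?_ hle hu, hg u hu]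
    · rwa [hev]
    · rwa [hev]

/-- The entering arc is the lighter one and keeps its label. It moves to a new head, so the pointer
to the arc entering that head is redirected. -/
theorem Elim.of_splice_left (h : Elim G X₀ S v A) (hv : v ∉ S) (hh : Hit m 1 7 v A)
    (ht : Hit m 0 8 v A) (hne : A 7 v ≠ A 8 v) (hle : A 2 (A 7 v) ≤ A 2 (A 8 v))
    (h1 : ∀ j, A' 1 j = if j = A 7 v then A 1 (A 8 v) else A 1 j)
    (h7 : ∀ j, A' 7 j = if j = A 1 (A 8 v) then A 7 v else A 7 j)
    (h5 : ∀ j, A' 5 j = if j = A 8 v then m else A 5 j)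
    (h0 : A' 0 = A 0) (h2 : A' 2 = A 2) (h8 : A' 8 = A 8) : Elim G X₀ S (v + 1) A' := by
  obtain ⟨X, hX, hL, hP, hE, hg, hc⟩ := h
  obtain ⟨e, he, hAe, hev, hin⟩ := hX.hit_head hP hv hh
  obtain ⟨f, hf, hAf, hfv, hout⟩ := hX.hit_tail hP hv ht
  rw [hAe, hAf] at hne
  simp only [hAe, hAf, hX.head, hX.weight] at hle h1 h7 h5
  have hef : e ≠ f := fun h => hne (h ▸ rfl)
  refine .of_splice (l := e) (k := f) hX hL hv hE hg hc he hf hev hfv hin hout hef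
    (Or.inl ⟨rfl, rfl⟩) hle (fun j => ?_) h1 h2 h5 ?_
  · rw [h0]
    split_ifs with h
    · rw [h, hX.tail]
    · rfl
  · intro g hg
    obtain ⟨hgf, hg⟩ := Finset.mem_erase.1 hg
    simp only [splice, Function.update_eq_self, h8]
    refine ⟨?_, (hP g hg).2⟩
    rw [h7, Function.update_apply]
    split_ifs with h3 h4 h4
    · exact fun _ => h3 ▸ rfl
    · exact absurd rfl h4
    -- A further arc with the same head as `f`, outside `S`, would share its pointer with `f` and
    -- hence equal `f`.
    · intro hS
      exfalso
      have h5 := (hP g hg).1 hS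
      have h6 := (hP f hf).1 (Fin.ext h4 ▸ hS)
      rw [h4, h6] at h5
      exact hgf (Fin.ext h5).symm
    · exact (hP g hg).1

theorem Elim.of_splice_right (h : Elim G X₀ S v A) (hv : v ∉ S) (hh : Hit m 1 7 v A)
    (ht : Hit m 0 8 v A) (hne : A 7 v ≠ A 8 v) (hle : A 2 (A 8 v) ≤ A 2 (A 7 v))
    (h0 : ∀ j, A' 0 j = if j = A 8 v then A 0 (A 7 v) else A 0 j)
    (h8 : ∀ j, A' 8 j = if j = A 0 (A 7 v) then A 8 v else A 8 j)
    (h5 : ∀ j, A' 5 j = if j = A 7 v then m else A 5 j)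
    (h1 : A' 1 = A 1) (h2 : A' 2 = A 2) (h7 : A' 7 = A 7) : Elim G X₀ S (v + 1) A' := by
  obtain ⟨X, hX, hL, hP, hE, hg, hc⟩ := h
  obtain ⟨e, he, hAe, hev, hin⟩ := hX.hit_head hP hv hh
  obtain ⟨f, hf, hAf, hfv, hout⟩ := hX.hit_tail hP hv ht
  rw [hAe, hAf] at hne
  simp only [hAe, hAf, hX.tail, hX.weight] at hle h0 h8 h5
  have hef : e ≠ f := fun h => hne (h ▸ rfl)
  refine .of_splice (l := f) (k := e) hX hL hv hE hg hc he hf hev hfv hin hout hef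
    (Or.inr ⟨rfl, rfl⟩) hle h0 (fun j => ?_) h2 h5 ?_
  · rw [h1]
    split_ifs with h
    · rw [h, hX.head]
    · rfl
  · intro g hg
    obtain ⟨hge, hg⟩ := Finset.mem_erase.1 hg
    simp only [splice, Function.update_eq_self, h7]
    refine ⟨(hP g hg).1, ?_⟩
    rw [h8, Function.update_apply]
    split_ifs with h3 h4 h4
    · exact fun _ => h3 ▸ rfl
    · exact absurd rfl h4
    · intro hS
      exfalso
      have h5 := (hP g hg).2 hS
      have h6 := (hP e he).2 (Fin.ext h4 ▸ hS)
      rw [h4, h6] at h5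
      exact hge (Fin.ext h5).symm
    · exact (hP g hg).2

end Branches

/-- The parallel arcs of `X₀` with labels less than `i` have been merged. -/
def Merged (G X₀ : WDigraph (Fin n) (Fin m)) (S : Finset (Fin n)) (i : ℕ) (A : ℕ → ℕ → ℕ) : Prop :=
  ∃ X : WDigraph (Fin n) (Fin m), Rep X A ∧ Lift G X (A 5) ∧
    (∀ e ∈ X.arcs, ∀ f ∈ X.arcs, e < i → f < i → X.tail e = X.tail f → X.head e = X.head f →
      e = f) ∧
    (∀ e ∈ X.arcs, e < i → A 10 (A 9 (A 0 e) + A 1 e) = e) ∧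
    (∀ u t, X.mat u t = X₀.mat u t) ∧ (∀ e ∈ X.arcs, X.tail e ∈ S ∧ X.head e ∈ S) ∧
    (X = X₀ ∨ X.arcs.card < X₀.arcs.card)

/-! ### Merging parallel arcs -/

section Merging

variable {G X₀ : WDigraph (Fin n) (Fin m)} {S : Finset (Fin n)} {i : ℕ} {A A' : ℕ → ℕ → ℕ}

theorem Merged.of_dead (h : Merged G X₀ S i A) (hi : i < m) (h5 : A 5 i ≠ i) :
    Merged G X₀ S (i + 1) A := by
  obtain ⟨X, hX, hL, hs, ht, hm, hS, hc⟩ := h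
  have hlt : ∀ e ∈ X.arcs, (e : ℕ) < i + 1 → (e : ℕ) < i := by
    intro e he hlt
    have : (e : ℕ) ≠ i := by
      rintro rfl
      exact h5 ((hX.alive e).2 he)
    omega
  exact ⟨X, hX, hL, fun e he f hf h1 h2 => hs e he f hf (hlt e he h1) (hlt f hf h2),
    fun e he h => ht e he (hlt e he h), hm, hS, hc⟩

theorem Merged.of_merge {c : ℕ} (h : Merged G X₀ S i A) (hi : i < m) (h5i : A 5 i = i) (hcm : c < m)
    (hci : c ≠ i) (h5c : A 5 c = c) (h0c : A 0 c = A 0 i) (h1c : A 1 c = A 1 i)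
    (h2 : ∀ j, A' 2 j = if j = c then A 2 c + A 2 i else A 2 j)
    (h5 : ∀ j, A' 5 j = if j = i then c else A 5 j)
    (h0 : A' 0 = A 0) (h1 : A' 1 = A 1) (h9 : A' 9 = A 9) (h10 : A' 10 = A 10) :
    Merged G X₀ S (i + 1) A' := by
  obtain ⟨X, hX, hL, hs, ht, hm, hS, hc⟩ := h
  lift c to Fin m using hcm
  lift i to Fin m using hi
  have hi : i ∈ X.arcs := (hX.alive i).1 h5i
  have hca : c ∈ X.arcs := (hX.alive c).1 h5c
  have hne : c ≠ i := fun h => hci (h ▸ rfl)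
  have htl : X.tail c = X.tail i := Fin.ext (by rw [← hX.tail, ← hX.tail, h0c])
  have hhd : X.head c = X.head i := Fin.ext (by rw [← hX.head, ← hX.head, h1c])
  have hlt : ∀ e, e ≠ i → (e : ℕ) < i + 1 → (e : ℕ) < i := by
    intro e he hlt
    have : (e : ℕ) ≠ i := fun h => he (Fin.ext h)
    omega
  refine ⟨X.mergeArc c i, hX.kill rfl hci ?_ ?_ ?_ h5, hL.kill hi h5i rfl hci h5c h5 ?_,
    ?_, ?_, ?_, fun e he => hS e (Finset.mem_of_mem_erase he),
    Or.inr (card_lt_of_erase hi rfl hc)⟩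
  · rw [h0]
    exact hX.tail
  · rw [h1]
    exact hX.head
  · intro e
    rw [h2]
    simp only [mergeArc, Function.update_apply, Fin.ext_iff, hX.weight]
  · intro T hT
    have hT' := hT.of_mergeArc hca hi hne htl hhd
    have hsel : Sel T c ↔ c ∈ T := by
      constructor
      · rintro (h | ⟨e, he, h⟩)
        · omega
        · rwa [← Fin.ext h]
      · exact fun h => Or.inr ⟨c, h, rfl⟩
    rw [hsel]
    refine ⟨fun h => ?_, fun h => ?_⟩
    · rwa [if_pos h] at hT'
    · rwa [if_neg h] at hT'
  · intro e he f hf h1 h2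
    obtain ⟨hei, he⟩ := Finset.mem_erase.1 he
    obtain ⟨hfi, hf⟩ := Finset.mem_erase.1 hf
    exact hs e he f hf (hlt e hei h1) (hlt f hfi h2)
  · intro e he h
    obtain ⟨hei, he⟩ := Finset.mem_erase.1 he
    rw [h10, h9, h0, h1]
    exact ht e he (hlt e hei h)
  · intro u t
    rw [mat_mergeArc hca hi hne htl hhd, hm]

/-- The table is never initialised; an entry counts only if it passes the test for a living parallel
arc. Each earlier living arc occupies its own cell, so a failed test excludes an earlier parallel
arc and the cell may be overwritten. -/
theorem Merged.of_new (h : Merged G X₀ S i A) (hi : i < m) (h5i : A 5 i = i)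
    (h9 : ∀ u < n, A 9 u = u * n)
    (hbad : ∀ c, c = A 10 (A 9 (A 0 i) + A 1 i) → c < m → c ≠ i → A 5 c = c → A 0 c = A 0 i →
      A 1 c ≠ A 1 i)
    (h10 : ∀ j, A' 10 j = if j = A 9 (A 0 i) + A 1 i then i else A 10 j)
    (hA : ∀ a, a ≠ 10 → A' a = A a) : Merged G X₀ S (i + 1) A' := by
  obtain ⟨X, hX, hL, hs, ht, hm, hS, hc⟩ := h
  lift i to Fin m using hi
  have hi : i ∈ X.arcs := (hX.alive i).1 h5i
  have hpar : ∀ e ∈ X.arcs, (e : ℕ) < i → X.tail e = X.tail i → X.head e = X.head i → False := by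
    intro e he hlt h1 h2
    have h3 := ht e he hlt
    rw [hX.tail, hX.head, h1, h2, ← hX.tail, ← hX.head] at h3
    refine hbad e h3.symm e.2 hlt.ne ((hX.alive e).2 he) ?_ ?_
    · rw [hX.tail, hX.tail, h1]
    · rw [hX.head, hX.head, h2]
  have hlt : ∀ e : Fin m, (e : ℕ) < i + 1 → e = i ∨ (e : ℕ) < i := by
    intro e h
    by_cases he : (e : ℕ) = i
    · exact Or.inl (Fin.ext he)
    · omega
  refine ⟨X, ⟨?_, ?_, ?_, ?_⟩, ?_, ?_, ?_, hm, hS, hc⟩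
  · rw [hA _ (by decide)]
    exact hX.tail
  · rw [hA _ (by decide)]
    exact hX.head
  · rw [hA _ (by decide)]
    exact hX.weight
  · rw [hA _ (by decide)]
    exact hX.alive
  · rw [hA _ (by decide)]
    exact hL
  · intro e he f hf h1 h2 h3 h4
    rcases hlt e h1 with rfl | h1 <;> rcases hlt f h2 with rfl | h2
    · rfl
    · exact (hpar f hf h2 h3.symm h4.symm).elim
    · exact (hpar e he h1 h3 h4).elim
    · exact hs e he f hf h1 h2 h3 h4
  · intro e he h
    rw [hA 9 (by decide), hA 0 (by decide), hA 1 (by decide), h10]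
    rcases hlt e h with rfl | h
    · rw [if_pos rfl]
    · rw [if_neg, ht e he h]
      intro heq
      rw [hX.tail, hX.tail, hX.head, hX.head, h9 _ (Fin.is_lt _), h9 _ (Fin.is_lt _)] at heq
      have h1 := (X.head e).2
      have h2 := (X.head i).2
      -- The cell `u * n + v` with `v < n` determines `u` as the quotient by `n`.
      have h3 : (X.tail e : ℕ) = X.tail i := by
        rw [add_comm, add_comm _ (X.head i : ℕ)] at heq
        have h4 := congrArg (fun x => x / n) heq
        beta_reduce at h4
        rwa [Nat.add_mul_div_right _ _ (by omega), Nat.div_eq_of_lt h1,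
          Nat.add_mul_div_right _ _ (by omega), Nat.div_eq_of_lt h2, zero_add, zero_add] at h4
      rw [h3] at heq
      exact hpar e he h (Fin.ext h3) (Fin.ext (by omega))

end Merging

end Ram

/-! ### The passes of one round -/

namespace Ram

open WDigraph Ram.Expr

variable {n m : ℕ}

/-- Zero if and only if `c` is the label of an arc whose end, given by the array `a`, is `u`. -/
def Expr.miss (a : ℕ) (c u : Expr) : Expr :=
  .add (.add (.not (.sub (.var 1) c)) (.ne (.get 5 c) c)) (.ne (.get a c) u)

theorem Expr.eval_miss (s : State) (a : ℕ) (c u : Expr) : (miss a c u).eval s = 0 ↔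
    c.eval s < s.var 1 ∧ s.arr 5 (c.eval s) = c.eval s ∧ s.arr a (c.eval s) = u.eval s := by
  simp only [miss, eval_add, Nat.add_eq_zero_iff, eval_ne, eval_not, eval_sub, eval_var, eval_get,
    and_assoc]
  exact and_congr_left fun _ => by omega

/-- Forget the branch vertices. -/
def clearLoop : Cmd := forLoop 5 0 (.store 6 (.var 5) (.lit 0))

theorem runs_clearLoop (s : State) (hn : s.var 0 = n) :
    Runs clearLoop s ((n + 1) * 20) fun s' => ∀ v < n, s'.arr 6 v = 0 := by
  refine (Runs.forLoop_straight (fun i s => ∀ v < i, s.arr 6 v = 0) s hn rfl (by decide) rfl rfl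
    (by simp) ?_).mono (Nat.mul_le_mul_left _ (by decide)) fun _ _ h => h
  intro i hi s' _ hx h v hv
  simp only [Cmd.run, State.setVar_arr, State.setArr_arr, eval_var, eval_lit, hx]
  split_ifs with h'
  · rfl
  · exact h v (by simp only [true_and] at h'; omega)

/-- Let the array `b` point to arcs with given end; the vertices with two such arcs are marked. -/
def scanBody (a b : ℕ) : Cmd :=
  .ite (.ne (.get 5 (.var 5)) (.var 5)) .skip
    (.ite (.add (miss a (.get b (.get a (.var 5))) (.get a (.var 5)))
        (.not (.ne (.get b (.get a (.var 5))) (.var 5))))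
      (.store b (.get a (.var 5)) (.var 5)) (.store 6 (.get a (.var 5)) (.lit 1)))

/-- Pointers left from earlier rounds do no harm: one that passes the test names a living arc at the
vertex, so if it differs from the current arc there really are two. -/
theorem runs_scan {X : WDigraph (Fin n) (Fin m)} {f : Fin m → Fin n} {S : Finset (Fin n)}
    {a b : ℕ} (s : State) (hm : s.var 1 = m) (hbs : b ≠ 5 ∧ b ≠ 6 ∧ b ≠ a) (ha : a ≠ 6)
    (hS : ∀ c ∈ X.arcs, ∀ e ∈ X.arcs, c ≠ e → f c = f e → f e ∈ S)
    (hX : Rep X s.arr) (hf : ∀ e : Fin m, s.arr a e = f e) :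
    Runs (forLoop 5 1 (scanBody a b)) s ((m + 1) * ((scanBody a b).bound + 10)) fun s' =>
      (∀ v : Fin n, s'.arr 6 v = s.arr 6 v ∨ s'.arr 6 v = 1 ∧ v ∈ S) ∧
        ∀ e ∈ X.arcs, s'.arr 6 (f e) = 1 ∨ s'.arr b (f e) = e := by
  refine (Runs.forLoop_straight (fun i s' =>
      (∀ v : Fin n, s'.arr 6 v = s.arr 6 v ∨ s'.arr 6 v = 1 ∧ v ∈ S) ∧
        ∀ e ∈ X.arcs, e < i → s'.arr 6 (f e) = 1 ∨ s'.arr b (f e) = e)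
    s hm rfl (by decide) rfl rfl ?_ ?_).mono le_rfl ?_
  · simp
  · rintro i hi s' hs hx ⟨hI1, hI2⟩
    have h5 : s'.arr 5 = s.arr 5 := hs.2 5 (by simp [forLoop, scanBody, Cmd.writesArr, hbs.1])
    have ha : s'.arr a = s.arr a :=
      hs.2 a (by simp [forLoop, scanBody, Cmd.writesArr, hbs.2.2, ha.symm])
    have hv1 : s'.var 1 = m := by rw [hs.1 1 rfl, hm]
    lift i to Fin m using hi
    have hlt : ∀ e : Fin m, (e : ℕ) < i + 1 → e = i ∨ (e : ℕ) < i := by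
      intro e h
      by_cases he : (e : ℕ) = i
      · exact Or.inl (Fin.ext he)
      · omega
    simp only [State.setVar_arr]
    unfold scanBody
    simp only [Cmd.run, Nat.add_eq_zero_iff, eval_add, eval_ne, eval_not, eval_miss, eval_get,
      eval_var, eval_lit, hx, h5, ha, hf, hv1]
    split_ifs with h1 h2
    · obtain ⟨⟨h3, h4, h6⟩, h7⟩ := h2
      generalize hc : s'.arr b (f i) = c at *
      lift c to Fin m using h3
      have hci : c ≠ i := by
        rintro rfl
        exact h7 ((eval_ne _ _ _).2 (by simp [hx, ha, hf, hc]))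
      have hfc : f c = f i := Fin.ext (by rw [← hf, h6])
      have hiS := hS c ((hX.alive c).1 h4) i ((hX.alive i).1 h1) hci hfc
      refine ⟨fun v => ?_, fun e he h => ?_⟩
      · simp only [State.setArr_arr, true_and]
        split_ifs with hv
        · exact Or.inr ⟨rfl, Fin.ext hv ▸ hiS⟩
        · exact hI1 v
      · simp only [State.setArr_arr, true_and, hbs.2.1, false_and, if_false]
        split_ifs with hv
        · exact Or.inl rfl
        · rcases hlt e h with rfl | h
          · exact absurd rfl hv
          · exact hI2 e he h
    · refine ⟨fun v => ?_, fun e he h => ?_⟩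
      · simp only [State.setArr_arr, hbs.2.1.symm, false_and, if_false]
        exact hI1 v
      · simp only [State.setArr_arr, true_and, hbs.2.1.symm, false_and, if_false]
        rcases hlt e h with rfl | h
        · exact Or.inr (if_pos rfl)
        · rcases hI2 e he h with h3 | h3
          · exact Or.inl h3
          · split_ifs with hv
            · by_cases hei : e = i
              · exact Or.inr (hei ▸ rfl)
              -- Overwriting a pointer to another living arc at this vertex is impossible: the test
              -- would have succeeded and marked the vertex.
              · exfalso
                refine h2 ⟨?_, fun h4 => hei ?_⟩
                · rw [← hv, h3]
                  exact ⟨e.2, (hX.alive e).2 he, (hf e)⟩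
                · rw [eval_ne] at h4
                  simp only [eval_get, eval_var, hx, ha, hf, ← hv, h3] at h4
                  exact Fin.ext h4
            · exact Or.inr h3
    · refine ⟨hI1, fun e he h => ?_⟩
      rcases hlt e h with rfl | h
      · exact absurd ((hX.alive e).2 he) h1
      · exact hI2 e he h
  · rintro s' - ⟨h1, h2⟩
    exact ⟨h1, fun e he => h2 e he e.2⟩

/-- Eliminate the vertices that are not marked. -/
def elimBody : Cmd :=
  .ite (.get 6 (.var 5)) .skip
    (.seq (.assign 6 (.get 7 (.var 5))) (.seq (.assign 7 (.get 8 (.var 5)))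
      (.ite (miss 1 (.var 6) (.var 5))
        (.ite (miss 0 (.var 7) (.var 5)) .skip (.store 5 (.var 7) (.var 1)))
        (.ite (miss 0 (.var 7) (.var 5)) (.store 5 (.var 6) (.var 1))
          (.ite (.ne (.var 6) (.var 7))
            (.ite (.sub (.get 2 (.var 6)) (.get 2 (.var 7)))
              (.seq (.store 0 (.var 7) (.get 0 (.var 6)))
                (.seq (.store 8 (.get 0 (.var 6)) (.var 7)) (.store 5 (.var 6) (.var 1))))
              (.seq (.store 1 (.var 6) (.get 1 (.var 7)))
                (.seq (.store 7 (.get 1 (.var 7)) (.var 6)) (.store 5 (.var 7) (.var 1)))))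
            (.store 5 (.var 6) (.add (.var 1) (.lit 1))))))))

theorem runs_elim {G X : WDigraph (Fin n) (Fin m)} {S : Finset (Fin n)} (s : State)
    (hn : s.var 0 = n) (hm : s.var 1 = m) (hX : Rep X s.arr) (hL : Lift G X (s.arr 5))
    (hP : Ptr S X s.arr) (h6 : ∀ v : Fin n, s.arr 6 v = 0 ↔ v ∉ S) :
    Runs (forLoop 5 0 elimBody) s ((n + 1) * (elimBody.bound + 10)) fun s' =>
      Elim G X S n s'.arr := by
  refine Runs.forLoop_straight (fun i s' => Elim G X S i s'.arr) s hn rfl (by decide) rfl rfl ?_ ?_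
  · exact ⟨X, hX, hL, hP, fun _ _ => ⟨fun _ => Nat.zero_le _, fun _ => Nat.zero_le _⟩,
      fun _ _ _ => rfl, Or.inl rfl⟩
  · intro i hi s' hs hx hI
    have hs6 : s'.arr 6 = s.arr 6 := hs.2 6 rfl
    have hv1 : s'.var 1 = m := by rw [hs.1 1 rfl, hm]
    lift i to Fin n using hi
    simp only [State.setVar_arr]
    unfold elimBody
    simp only [Cmd.run, eval_get, eval_var, hx, hs6]
    by_cases h1 : s.arr 6 i = 0
    swap
    · rw [if_neg h1]
      exact hI.of_mem (by_contra fun h => h1 ((h6 i).2 h))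
    rw [if_pos h1]
    have hiS := (h6 i).1 h1
    simp only [eval_miss, eval_ne, eval_sub, eval_get, eval_var, eval_add, eval_lit, State.setVar_var,
      State.setVar_arr, hx, hv1, reduceIte, Nat.reduceEqDiff, OfNat.one_ne_ofNat]
    split_ifs with h2 h3 h4 h5 h3
    · exact hI.of_loop hiS h2 h3 h4 (fun j => by simp) (fun a ha => by
        funext j
        simp [ha])
    · have h6 := Ne.symm h4
      refine hI.of_splice_left hiS h2 h3 h4 (by omega) (fun j => ?_) (fun j => ?_) (fun j => ?_)
        (funext fun j => ?_) (funext fun j => ?_) (funext fun j => ?_)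
      all_goals simp [h6, hv1]
    · have h6 := Ne.symm h4
      refine hI.of_splice_right hiS h2 h3 h4 (by omega) (fun j => ?_) (fun j => ?_) (fun j => ?_)
        (funext fun j => ?_) (funext fun j => ?_) (funext fun j => ?_)
      all_goals simp [h4, hv1]
    · exact hI.of_hit_head hiS h2 h3 (fun j => by simp) (fun a ha => by
        funext j
        simp [ha])
    · exact hI.of_hit_tail hiS h2 h3 (fun j => by simp) (fun a ha => by
        funext j
        simp [ha])
    · exact hI.of_not_hit hiS h2 h3

/-- Merge the arc with an arc parallel to it, or record it in the table. -/
def mergeBody : Cmd :=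
  .ite (.ne (.get 5 (.var 5)) (.var 5)) .skip
    (.seq (.assign 7 (.add (.get 9 (.get 0 (.var 5))) (.get 1 (.var 5))))
      (.seq (.assign 6 (.get 10 (.var 7)))
        (.ite (.add (.add (miss 0 (.var 6) (.get 0 (.var 5)))
            (.ne (.get 1 (.var 6)) (.get 1 (.var 5)))) (.not (.ne (.var 6) (.var 5))))
          (.store 10 (.var 7) (.var 5))
          (.seq (.store 2 (.var 6) (.add (.get 2 (.var 6)) (.get 2 (.var 5))))
            (.store 5 (.var 5) (.var 6))))))

theorem runs_merge {G X : WDigraph (Fin n) (Fin m)} {S : Finset (Fin n)} (s : State)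
    (hm : s.var 1 = m) (hX : Rep X s.arr) (hL : Lift G X (s.arr 5))
    (hS : ∀ e ∈ X.arcs, X.tail e ∈ S ∧ X.head e ∈ S) (h9 : ∀ u < n, s.arr 9 u = u * n) :
    Runs (forLoop 5 1 mergeBody) s ((m + 1) * (mergeBody.bound + 10)) fun s' =>
      Merged G X S m s'.arr := by
  refine Runs.forLoop_straight (fun i s' => Merged G X S i s'.arr) s hm rfl (by decide) rfl rfl ?_ ?_
  · refine ⟨X, hX, hL, ?_, ?_, fun _ _ => rfl, hS, Or.inl rfl⟩ <;> simp
  · intro i hi s' hs hx hI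
    have hs9 : s'.arr 9 = s.arr 9 := hs.2 9 rfl
    have hv1 : s'.var 1 = m := by rw [hs.1 1 rfl, hm]
    simp only [State.setVar_arr]
    unfold mergeBody
    simp only [Cmd.run, eval_ne, eval_get, eval_var, hx]
    by_cases h1 : s'.arr 5 i = i
    swap
    · rw [if_neg h1]
      exact hI.of_dead hi h1
    rw [if_pos h1]
    simp only [Nat.add_eq_zero_iff, eval_miss, eval_not, Ne, eval_ne, eval_get, eval_var, eval_add,
      State.setVar_var,
      State.setVar_arr, hx, hv1, reduceIte, Nat.reduceEqDiff, OfNat.one_ne_ofNat]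
    split_ifs with h2
    · obtain ⟨⟨⟨h3, h4, h5⟩, h6⟩, h7⟩ := h2
      refine hI.of_merge hi h1 h3 h7 h4 h5 h6 (fun j => ?_) (fun j => ?_)
        (funext fun j => ?_) (funext fun j => ?_) (funext fun j => ?_) (funext fun j => ?_)
      all_goals simp [hx]
    · refine hI.of_new hi h1 (by rwa [hs9]) ?_ (fun j => ?_) (fun a ha => ?_)
      · rintro c rfl h3 h4 h5 h6 h7
        exact h2 ⟨⟨⟨h3, h5, h6⟩, h7⟩, h4⟩
      · simp
      · funext j
        simp [ha]

end Ram

/-! ### Rounds and stationarity -/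

namespace Ram

open WDigraph Ram.Expr

variable {n m : ℕ}

/-- One round of the construction. -/
def round : Cmd :=
  .seq clearLoop (.seq (forLoop 5 1 (scanBody 1 7)) (.seq (forLoop 5 1 (scanBody 0 8))
    (.seq (forLoop 5 0 elimBody) (forLoop 5 1 mergeBody))))

/-- `X'` is the term after `X`, and the array `6` marks its vertices. -/
structure IsRound (X X' : WDigraph (Fin n) (Fin m)) (A : ℕ → ℕ → ℕ) : Prop where
  simple : X'.Simple
  mat_eq : ∀ u t, X'.mat u t = X.gamma.mat u t
  marked : ∀ v : Fin n, A 6 v = 0 ↔ v ∉ X.gammaVerts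

theorem IsRound.step_eq {X X' : WDigraph (Fin n) (Fin m)} {A : ℕ → ℕ → ℕ} (h : IsRound X X' A) :
    X'.step = X.step.step :=
  h.simple.step_eq_step_phi h.mat_eq

theorem runs_round {G X : WDigraph (Fin n) (Fin m)} (s : State) (hn : s.var 0 = n)
    (hm : s.var 1 = m) (hX : Rep X s.arr) (hL : Lift G X (s.arr 5))
    (h9 : ∀ u < n, s.arr 9 u = u * n) :
    Runs round s ((n + m + 1) * 1000) fun s' => ∃ X', Rep X' s'.arr ∧ Lift G X' (s'.arr 5) ∧
      IsRound X X' s'.arr ∧ (X' = X ∨ X'.arcs.card < X.arcs.card) := by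
  have hmS := X.mem_gammaVerts
  have hrep : ∀ {s₁ s₂ : State}, Rep X s₁.arr → (∀ a, a = 0 ∨ a = 1 ∨ a = 2 ∨ a = 5 →
      s₂.arr a = s₁.arr a) → Rep X s₂.arr := by
    intro s₁ s₂ h ha
    refine ⟨?_, ?_, ?_, ?_⟩
    · rw [ha 0 (by simp)]
      exact h.tail
    · rw [ha 1 (by simp)]
      exact h.head
    · rw [ha 2 (by simp)]
      exact h.weight
    · rw [ha 5 (by simp)]
      exact h.alive
  refine Runs.mono (Q := fun s' => ∃ X', Rep X' s'.arr ∧ Lift G X' (s'.arr 5) ∧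
      IsRound X X' s'.arr ∧ (X' = X ∨ X'.arcs.card < X.arcs.card))
    (t := (n + 1) * 20 + ((m + 1) * ((scanBody 1 7).bound + 10) +
      ((m + 1) * ((scanBody 0 8).bound + 10) + ((n + 1) * (elimBody.bound + 10) +
        (m + 1) * (mergeBody.bound + 10))))) ?_ ?_ fun _ _ h => h
  · refine (runs_clearLoop s hn).seq fun s₁ f₁ hc => ?_
    have hX₁ : Rep X s₁.arr := hrep hX fun a ha => f₁.2 a (by
      rcases ha with rfl | rfl | rfl | rfl <;> rfl)
    refine (runs_scan (X := X) (f := X.head) (S := X.gammaVerts) s₁ (by rw [f₁.1 1 rfl, hm])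
      (by decide) (by decide) ?_ hX₁ hX₁.head).seq fun s₂ f₂ ⟨h₂, h₂'⟩ => ?_
    · exact fun c hc e he hne h => (hmS _).2 (Or.inl ⟨c, hc, e, he, h, rfl, hne⟩)
    have hX₂ : Rep X s₂.arr := hrep hX₁ fun a ha => f₂.2 a (by
      rcases ha with rfl | rfl | rfl | rfl <;> rfl)
    refine (runs_scan (X := X) (f := X.tail) (S := X.gammaVerts) s₂
      (by rw [f₂.1 1 rfl, f₁.1 1 rfl, hm])
      (by decide) (by decide) ?_ hX₂ hX₂.tail).seq fun s₃ f₃ ⟨h₃, h₃'⟩ => ?_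
    · exact fun c hc e he hne h => (hmS _).2 (Or.inr ⟨c, hc, e, he, h, rfl, hne⟩)
    have hX₃ : Rep X s₃.arr := hrep hX₂ fun a ha => f₃.2 a (by
      rcases ha with rfl | rfl | rfl | rfl <;> rfl)
    have h₂'' : ∀ e ∈ X.arcs, s₃.arr 6 (X.head e) = 1 ∨ s₃.arr 7 (X.head e) = e := by
      intro e he
      rw [f₃.2 7 rfl]
      rcases h₂' e he with h | h
      · rcases h₃ (X.head e) with h' | h'
        · exact Or.inl (h'.trans h)
        · exact Or.inl h'.1
      · exact Or.inr h
    -- Two arcs entering, or two arcs leaving, an unmarked vertex would both be the arc pointed to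
    -- there.
    have hS : ∀ v : Fin n, s₃.arr 6 v = 0 ↔ v ∉ X.gammaVerts := by
      intro v
      constructor
      · intro h0 hv
        rcases (hmS v).1 hv with ⟨e, he, f, hf, rfl, hef, hne⟩ | ⟨e, he, f, hf, rfl, hef, hne⟩
        · have h4 := h₂'' e he
          have h5 := h₂'' f hf
          rw [h0] at h4
          rw [hef, h0] at h5
          exact hne (Fin.ext ((h4.resolve_left (by simp)).symm.trans (h5.resolve_left (by simp))))
        · have h4 := h₃' e he
          have h5 := h₃' f hf
          rw [h0] at h4
          rw [hef, h0] at h5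
          exact hne (Fin.ext ((h4.resolve_left (by simp)).symm.trans (h5.resolve_left (by simp))))
      · intro hv
        rcases h₃ v with h | h
        · rcases h₂ v with h' | h'
          · rw [h, h', hc v v.2]
          · exact absurd h'.2 hv
        · exact absurd h.2 hv
    have hP : Ptr X.gammaVerts X s₃.arr := by
      intro e he
      refine ⟨fun h => (h₂'' e he).resolve_left ?_, fun h => (h₃' e he).resolve_left ?_⟩
      · rw [(hS _).2 h]
        simp
      · rw [(hS _).2 h]
        simp
    refine (runs_elim (G := G) s₃ (by rw [f₃.1 0 rfl, f₂.1 0 rfl, f₁.1 0 rfl, hn])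
      (by rw [f₃.1 1 rfl, f₂.1 1 rfl, f₁.1 1 rfl, hm]) hX₃
      (by rwa [f₃.2 5 rfl, f₂.2 5 rfl, f₁.2 5 rfl]) hP hS).seq fun s₄ f₄ h₄ => ?_
    obtain ⟨X₁, hX₁, hL₁, -, hE, hg, hcard⟩ := h₄
    have hE' : ∀ e ∈ X₁.arcs, X₁.tail e ∈ X.gammaVerts ∧ X₁.head e ∈ X.gammaVerts := by
      intro e he
      have h1 := (X₁.tail e).2
      have h2 := (X₁.head e).2
      refine ⟨by_contra fun h => ?_, by_contra fun h => ?_⟩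
      · have := (hE e he).2 h
        omega
      · have := (hE e he).1 h
        omega
    have hmat : ∀ u t, X₁.mat u t = X.gamma.mat u t := by
      intro u t
      rw [mat_gamma]
      split_ifs with hu
      · rw [← hg u hu, gmat_eq_mat fun e he => (hE' e he).2]
      · by_contra h
        obtain ⟨e, he, rfl, -⟩ := (mat_pos_iff _ _ _).1 (Nat.pos_of_ne_zero h)
        exact hu (hE' e he).1
    refine (runs_merge s₄ (by rw [f₄.1 1 rfl, f₃.1 1 rfl, f₂.1 1 rfl, f₁.1 1 rfl, hm]) hX₁ hL₁ hE'
      (by rwa [f₄.2 9 rfl, f₃.2 9 rfl, f₂.2 9 rfl, f₁.2 9 rfl])).mono le_rfl fun s₅ f₅ h₅ => ?_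
    obtain ⟨X₂, hX₂, hL₂, hs, -, hm₂, -, hc₂⟩ := h₅
    refine ⟨X₂, hX₂, hL₂, ⟨fun e he f hf => hs e he f hf e.2 f.2, fun u t => ?_, ?_⟩, ?_⟩
    · rw [hm₂, hmat]
    · rwa [f₅.2 6 rfl, f₄.2 6 rfl]
    · rcases hc₂ with rfl | hc₂
      · exact hcard
      · rcases hcard with rfl | hcard
        · exact Or.inr hc₂
        · exact Or.inr (hc₂.trans hcard)
  · have h1 : (scanBody 1 7).bound + 10 ≤ 200 := by decide
    have h2 : (scanBody 0 8).bound + 10 ≤ 200 := by decide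
    have h3 : elimBody.bound + 10 ≤ 200 := by decide
    have h4 : mergeBody.bound + 10 ≤ 200 := by decide
    nlinarith [Nat.mul_le_mul_left (m + 1) h1, Nat.mul_le_mul_left (m + 1) h2,
      Nat.mul_le_mul_left (n + 1) h3, Nat.mul_le_mul_left (m + 1) h4]

/-- The rounds up to the essential minor. -/
def core : Cmd :=
  .seq (.assign 3 (.add (.var 1) (.lit 2))) (.seq (forLoop 5 3 (.store 5 (.var 5) (.var 5)))
    (.seq (.assign 8 (.lit 0))
      (.seq (forLoop 5 0 (.seq (.store 9 (.var 5) (.var 8)) (.assign 8 (.add (.var 8) (.var 0)))))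
        (forLoop 4 3 round))))

/-- The memory after the last round. -/
structure IsCore (G X X' : WDigraph (Fin n) (Fin m)) (A : ℕ → ℕ → ℕ) : Prop where
  minor : G.IsEssentialMinor X.step
  rep : Rep X' A
  lift : Lift G X' (A 5)
  isRound : IsRound X X' A

/-- Until the sequence is stationary each round loses an arc, and there are only `m` of them. Thus
the number of rounds is fixed in advance and no test for equality of graphs is needed. -/
theorem runs_core {G : WDigraph (Fin n) (Fin m)} (s : State) (hG : G.arcs = Finset.univ)
    (hn : s.var 0 = n) (hm : s.var 1 = m) (h0 : ∀ e : Fin m, s.arr 0 e = G.tail e)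
    (h1 : ∀ e : Fin m, s.arr 1 e = G.head e) (h2 : ∀ e : Fin m, s.arr 2 e = G.weight e) :
    Runs core s ((n + m + 1) * (m + 4) * 2000) fun s' => ∃ X X', IsCore G X X' s'.arr := by
  refine Runs.mono (Q := fun s' => ∃ X X', IsCore G X X' s'.arr)
    (t := (4 + ((m + 2 + 1) * 13 + (2 + ((n + 1) * 17 + (m + 2 + 1) * ((n + m + 1) * 1000 + 10))))))
    ?_ ?_ fun _ _ h => h
  · refine (Runs.assign (Q := fun s' => s' = s.setVar 3 (m + 2)) (by simp [hm])).seq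
      fun s₁ f₁ e₁ => ?_
    refine (Runs.forLoop_straight (fun i s' => ∀ x < i, s'.arr 5 x = x) s₁
      (N := m + 2) (by simp [e₁]) rfl (by decide) rfl rfl (by simp) ?_).seq fun s₂ f₂ h₅ => ?_
    · intro i _ s' _ hx hI x hxi
      simp only [Cmd.run, State.setVar_arr, State.setArr_arr, eval_var, hx]
      split_ifs with h
      · exact h.2.symm
      · exact hI x (by simp only [true_and] at h; omega)
    refine (Runs.assign (Q := fun s' => s' = s₂.setVar 8 0) (by simp)).seq fun s₃ f₃ e₃ => ?_
    have hn₃ : s₃.var 0 = n := by rw [f₃.1 0 rfl, f₂.1 0 rfl, f₁.1 0 rfl, hn]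
    refine (Runs.forLoop_straight (fun i s' => s'.var 8 = i * n ∧ ∀ u < i, s'.arr 9 u = u * n) s₃
      hn₃ rfl (by decide) rfl rfl (by simp [e₃]) ?_).seq fun s₄ f₄ h₉ => ?_
    · intro i _ s' f hx ⟨hI, hI'⟩
      have hn' : s'.var 0 = n := by rw [f.1 0 rfl, hn₃]
      refine ⟨?_, fun u hu => ?_⟩
      · simp [Cmd.run, hI, hn', add_mul]
      · simp only [Cmd.run, State.setVar_arr, State.setArr_arr, eval_var, hx]
        split_ifs with h
        · rw [h.2, hI]
        · exact hI' u (by simp only [true_and] at h; omega)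
    have hn₄ : s₄.var 0 = n := by rw [f₄.1 0 rfl, hn₃]
    have hm₄ : s₄.var 1 = m := by rw [f₄.1 1 rfl, f₃.1 1 rfl, f₂.1 1 rfl, f₁.1 1 rfl, hm]
    have harr : ∀ a, a ≠ 5 → a ≠ 9 → s₄.arr a = s.arr a := by
      intro a h5 h9
      rw [f₄.2 a (by simp [forLoop, Cmd.writesArr, h9.symm]), f₃.2 a rfl,
        f₂.2 a (by simp [forLoop, Cmd.writesArr, h5.symm]), f₁.2 a rfl]
    have h₅' : ∀ x < m + 2, s₄.arr 5 x = x := by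
      rw [f₄.2 5 rfl, f₃.2 5 rfl]
      exact h₅
    -- The last clause keeps the graph before the latest round, because the memory describes its
    -- `step` through `IsRound`.
    refine (Runs.forLoop (N := m + 2) (c := (n + m + 1) * 1000) (fun i s' => ∃ X', Rep X' s'.arr ∧
        Lift G X' (s'.arr 5) ∧ X'.step = step^[i] G.step ∧
        (X'.step.step = X'.step ∨ X'.arcs.card + i ≤ m) ∧
        (0 < i → ∃ X, IsRound X X' s'.arr ∧ X.step = step^[i - 1] G.step ∧
          (X.step.step = X.step ∨ X.arcs.card + (i - 1) ≤ m))) s₄ ?_ (by decide) rfl rfl ?_ ?_).mono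
      le_rfl ?_
    · rw [f₄.1 3 rfl, f₃.1 3 rfl, f₂.1 3 rfl, e₁]
      simp
    · refine ⟨G, ⟨?_, ?_, ?_, ?_⟩, Lift.refl G h₅', rfl, Or.inr ?_, by simp⟩
      · rwa [State.setVar_arr, harr 0 (by decide) (by decide)]
      · rwa [State.setVar_arr, harr 1 (by decide) (by decide)]
      · rwa [State.setVar_arr, harr 2 (by decide) (by decide)]
      · intro e
        simp [hG, h₅' e (by omega)]
      · simp [hG]
    · rintro i hi s' f hx ⟨X, hX, hL, hstep, hc, -⟩
      refine (runs_round s' (by rw [f.1 0 rfl, hn₄]) (by rw [f.1 1 rfl, hm₄]) hX hL ?_).mono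
        le_rfl ?_
      · rw [f.2 9 rfl]
        exact h₉.2
      · rintro s'' - ⟨X', hX', hL', hr, hc'⟩
        refine ⟨X', hX', hL', ?_, ?_, fun _ => ⟨X, hr, hstep, hc⟩⟩
        · rw [hr.step_eq, hstep, Function.iterate_succ_apply']
        · rw [hr.step_eq]
          rcases hc with hc | hc
          · rw [hc, hc]
            exact Or.inl rfl
          -- For an unchanged graph `IsRound.step_eq` itself says that its `step` is fixed.
          · rcases hc' with rfl | hc'
            · left
              rw [← hr.step_eq, ← hr.step_eq]
            · right
              omega
    · rintro s' - ⟨X', hX', hL', -, -, hlast⟩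
      obtain ⟨X, hr, hstep, hc⟩ := hlast (by omega)
      -- Before the last of the `m + 2` rounds, the alternative would read `X.arcs.card + (m + 1) ≤
      -- m`.
      refine ⟨X, X', ⟨m + 1, hstep, hc.resolve_right ?_⟩, hX', hL', hr⟩
      omega
  · nlinarith [Nat.zero_le (n * m), Nat.zero_le (m * m)]

end Ram

/-! ### The essential minor and the size of a connected graph -/

namespace WDigraph

variable {V E E' : Type*} [DecidableEq V]

/-- Without parallel arcs, naming arcs by their endpoints is a weight-preserving bijection onto the
arcs of `Y.phi`. -/
theorem IsOptimalFAS.of_phi [DecidableEq E] {X : WDigraph V E} {Y : WDigraph V E'} (hs : X.Simple)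
    (hm : ∀ u v, X.mat u v = Y.mat u v) {L : Finset (V × V)} (hL : Y.phi.IsOptimalFAS L)
    {T : Finset E} (hT : ∀ e, e ∈ T ↔ e ∈ X.arcs ∧ (X.tail e, X.head e) ∈ L) :
    X.IsOptimalFAS T := by
  have harc : ∀ e ∈ X.arcs, (X.tail e, X.head e) ∈ Y.phi.arcs := by
    intro e he
    rw [mem_phi_arcs, ← hm, mat_pos_iff]
    exact ⟨e, he, rfl, rfl⟩
  have harc' : ∀ p ∈ Y.phi.arcs, ∃ e ∈ X.arcs, (X.tail e, X.head e) = p := by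
    intro p hp
    rw [mem_phi_arcs, ← hm, mat_pos_iff] at hp
    obtain ⟨e, he, h1, h2⟩ := hp
    exact ⟨e, he, Prod.ext h1 h2⟩
  have hinj : Set.InjOn (fun e => (X.tail e, X.head e)) X.arcs := by
    intro e he f hf h
    simp only [Prod.mk.injEq] at h
    exact hs e he f hf h.1 h.2
  have hsum : ∀ U ⊆ X.arcs, ∑ p ∈ U.image (fun e => (X.tail e, X.head e)), Y.phi.weight p =
      ∑ e ∈ U, X.weight e := by
    intro U hU
    rw [Finset.sum_image (hinj.mono (Finset.coe_subset.2 hU))]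
    refine Finset.sum_congr rfl fun e he => ?_
    rw [phi_weight, ← hm]
    exact hs.mat_eq (hU he)
  have hTsub : T ⊆ X.arcs := fun e he => ((hT e).1 he).1
  have himg : T.image (fun e => (X.tail e, X.head e)) = L := by
    ext p
    rw [Finset.mem_image]
    constructor
    · rintro ⟨e, he, rfl⟩
      exact ((hT e).1 he).2
    · intro hp
      obtain ⟨e, he, rfl⟩ := harc' p (hL.1.1 hp)
      exact ⟨e, (hT e).2 ⟨he, hp⟩, rfl⟩
  refine ⟨⟨hTsub, fun v hv => hL.1.2 v (Relation.TransGen.mono ?_ _ _ hv)⟩, fun U hU => ?_⟩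
  · rintro _ _ ⟨e, ⟨he, heT⟩, rfl, rfl⟩
    exact ⟨_, ⟨harc e he, fun h => heT ((hT e).2 ⟨he, h⟩)⟩, rfl, rfl⟩
  · rw [← hsum T hTsub, himg, ← hsum U hU.1]
    refine hL.2 _ ⟨?_, fun v hv => hU.2 v (Relation.TransGen.mono ?_ _ _ hv)⟩
    · exact Finset.image_subset_iff.2 fun e he => harc e (hU.1 he)
    · rintro _ _ ⟨p, ⟨hp, hpU⟩, rfl, rfl⟩
      obtain ⟨e, he, rfl⟩ := harc' p hp
      exact ⟨e, ⟨he, fun h => hpU (Finset.mem_image_of_mem _ h)⟩, rfl, rfl⟩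

theorem IsEssentialMinor.unique {G : WDigraph V E} {C D : WDigraph V (V × V)}
    (hC : G.IsEssentialMinor C) (hD : G.IsEssentialMinor D) : C = D := by
  obtain ⟨K, rfl, h⟩ := hC
  obtain ⟨L, rfl, h'⟩ := hD
  rw [← Function.iterate_fixed h L, ← Function.iterate_fixed h' K, ← Function.iterate_add_apply,
    ← Function.iterate_add_apply, add_comm]

/-- The underlying simple graph is connected and has at most `m` edges, since loops vanish and
parallel arcs coincide. -/
theorem Connected.card_le {n m : ℕ} {G : WDigraph (Fin n) (Fin m)} (h : G.Connected)
    (hv : G.verts = Finset.univ) : n ≤ m + 1 := by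
  rcases Nat.eq_zero_or_pos n with rfl | hn
  · exact Nat.zero_le _
  let H : SimpleGraph (Fin n) := .fromRel fun u v => ∃ e, G.tail e = u ∧ G.head e = v
  have hH : H.Connected := by
    have : Nonempty (Fin n) := ⟨⟨0, hn⟩⟩
    refine ⟨fun u v => ?_⟩
    have huv := h u (hv ▸ Finset.mem_univ _) v (hv ▸ Finset.mem_univ _)
    induction huv with
    | rel u v huv =>
      obtain ⟨e, -, he⟩ := huv
      by_cases hne : u = v
      · subst hne
        exact .refl _
      · exact SimpleGraph.Adj.reachable (G := H) ⟨hne, Or.inl ⟨e, he⟩⟩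
    | refl u => exact .refl _
    | symm u v _ ih => exact ih.symm
    | trans u v w _ _ ih1 ih2 => exact ih1.trans ih2
  have h1 := hH.card_vert_le_card_edgeSet_add_one
  have h2 : H.edgeSet ⊆ Set.range fun e : Fin m => s(G.tail e, G.head e) := by
    intro p
    induction p with
    | h u v =>
      rintro ⟨-, ⟨e, rfl, rfl⟩ | ⟨e, rfl, rfl⟩⟩
      · exact ⟨e, rfl⟩
      · exact ⟨e, Sym2.eq_swap⟩
  have h3 := Set.ncard_le_ncard h2 (Set.finite_range _)
  have h4 : (Set.range fun e : Fin m => s(G.tail e, G.head e)).ncard ≤ m := by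
    rw [← Set.image_univ]
    refine (Set.ncard_image_le).trans ?_
    simp [Set.ncard_univ]
  rw [Nat.card_coe_set_eq, Nat.card_eq_fintype_card, Fintype.card_fin] at h1
  omega

end WDigraph

/-! ### Writing the output -/

namespace Ram

open WDigraph Ram.Expr

variable {n m : ℕ}

theorem State.Holds.append {s s' : State} {a x : ℕ} {l : List ℕ} (h : s.Holds a l)
    (hs : ∀ j, s'.arr a j = if j = l.length then x else s.arr a j) : s'.Holds a (l ++ [x]) := by
  intro j hj
  rw [hs]
  simp only [List.length_append, List.length_singleton] at hj
  split_ifs with hjl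
  · subst hjl
    simp
  · rw [List.getElem_append_left (by omega), h j (by omega)]

theorem getD_ofFn (f : Fin m → ℕ) (e : Fin m) : ofList (List.ofFn f) e = f e := by
  simp [ofList]

/-- The left side is the form in which the coerced lists of the output predicates are elaborated. -/
theorem map_val_coe {k : ℕ} (l : List (Fin k)) :
    (List.map (fun v => v) do let a ← l; pure (a : ℕ)) = l.map fun v : Fin k => (v : ℕ) := by
  rw [List.map_id']
  exact (List.map_eq_flatMap ..).symm

/-- List the marked vertices and the arcs. -/
def writeGraph : Cmd :=
  .seq (.assign 6 (.lit 0)) (.seq (forLoop 5 0 (.ite (.get 6 (.var 5))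
    (.seq (.store 3 (.var 6) (.var 5)) (.assign 6 (.add (.var 6) (.lit 1)))) .skip))
  (.seq (.assign 7 (.lit 0)) (.seq (forLoop 5 1 (.ite (.ne (.get 5 (.var 5)) (.var 5)) .skip
    (.seq (.store 0 (.var 7) (.get 0 (.var 5))) (.seq (.store 1 (.var 7) (.get 1 (.var 5)))
      (.seq (.store 2 (.var 7) (.get 2 (.var 5))) (.assign 7 (.add (.var 7) (.lit 1))))))))
  (.seq (.assign 0 (.var 6)) (.assign 1 (.var 7))))))

theorem runs_writeGraph {G X X' : WDigraph (Fin n) (Fin m)} (s : State) (hn : s.var 0 = n)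
    (hm : s.var 1 = m) (hc : IsCore G X X' s.arr) :
    Runs writeGraph s ((n + m + 1) * 200) fun s' => s'.OutputsDigraph X.step := by
  obtain ⟨-, hX, -, hr⟩ := hc
  refine Runs.mono (Q := fun s' => s'.OutputsDigraph X.step)
    (t := 2 + ((n + 1) * 50 + (2 + ((m + 1) * 50 + (2 + 2))))) ?_ (by nlinarith) fun _ _ h => h
  refine (Runs.assign (Q := fun s' => s' = s.setVar 6 0) (by simp)).seq fun s₁ f₁ e₁ => ?_
  refine ((Runs.forLoop_straight (fun i s' => ∃ l : List (Fin n), l.Nodup ∧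
    (∀ v, v ∈ l ↔ v < i ∧ s.arr 6 v ≠ 0) ∧ s'.var 6 = l.length ∧
      s'.Holds 3 (l.map fun v : Fin n => (v : ℕ))) s₁ (by rw [f₁.1 0 rfl, hn]) rfl (by decide) rfl rfl
      ?_ ?_).mono (Nat.mul_le_mul_left _ (by decide)) fun _ _ h => h).seq
      fun s₂ f₂ ⟨l, hl, hlm, hlv, hl3⟩ => ?_
  · exact ⟨[], by simp, by simp, by simp [e₁], by simp [State.Holds]⟩
  · rintro i hi s' f hx ⟨l, hl, hlm, hlv, hl3⟩
    have h6 : s'.arr 6 = s.arr 6 := by rw [f.2 6 rfl, f₁.2 6 rfl]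
    lift i to Fin n using hi
    simp only [Cmd.run, eval_get, eval_var, hx, h6]
    split_ifs with h
    · refine ⟨l, hl, fun v => ?_, by simp [hlv], hl3⟩
      rw [hlm]
      refine and_congr_left fun hv => ?_
      have : (v : ℕ) ≠ i := fun h' => hv (h' ▸ h)
      omega
    · refine ⟨l ++ [i], ?_, fun v => ?_, by simp [hlv], ?_⟩
      · rw [List.nodup_append]
        refine ⟨hl, List.nodup_singleton _, fun v hv w hw => ?_⟩
        rintro rfl
        have := ((hlm v).1 hv).1
        rw [List.mem_singleton.1 hw] at this
        omega
      · rw [List.mem_append, List.mem_singleton, hlm, Fin.ext_iff]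
        constructor
        · rintro (h' | h')
          · exact ⟨by omega, h'.2⟩
          · exact ⟨by omega, h' ▸ h⟩
        · rintro ⟨h1, h2⟩
          by_cases h3 : (v : ℕ) = i
          · exact Or.inr h3
          · exact Or.inl ⟨by omega, h2⟩
      · rw [List.map_append]
        exact hl3.append fun j => by simp [hlv]
  refine (Runs.assign (Q := fun s' => s' = s₂.setVar 7 0) (by simp)).seq fun s₃ f₃ e₃ => ?_
  have harr : ∀ a, a ≠ 3 → s₃.arr a = s.arr a := by
    intro a h
    rw [f₃.2 a rfl, f₂.2 a (by simp [forLoop, Cmd.writesArr, h.symm]), f₁.2 a rfl]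
  -- The arcs are compacted in place. Since `l.length ≤ i`, writing never overtakes reading and the
  -- entries from `i` on are intact.
  refine ((Runs.forLoop_straight (fun i s' => ∃ l : List (Fin m), l.Nodup ∧
    (∀ e, e ∈ l ↔ e < i ∧ e ∈ X'.arcs) ∧ s'.var 7 = l.length ∧ l.length ≤ i ∧
      s'.Holds 0 (l.map fun e => (X'.tail e : ℕ)) ∧ s'.Holds 1 (l.map fun e => (X'.head e : ℕ)) ∧
      s'.Holds 2 (l.map fun e => X'.weight e) ∧ ∀ e : Fin m, i ≤ e →
        s'.arr 0 e = X'.tail e ∧ s'.arr 1 e = X'.head e ∧ s'.arr 2 e = X'.weight e) s₃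
      (by rw [f₃.1 1 rfl, f₂.1 1 rfl, f₁.1 1 rfl, hm]) rfl (by decide) rfl rfl
      ?_ ?_).mono (Nat.mul_le_mul_left _ (by decide)) fun _ _ h => h).seq
      fun s₄ f₄ ⟨k, hk, hkm, hkv, _, hk0, hk1, hk2, _⟩ => ?_
  · refine ⟨[], by simp, by simp, by simp [e₃], by simp, by simp [State.Holds],
      by simp [State.Holds], by simp [State.Holds], fun e _ => ?_⟩
    rw [State.setVar_arr, harr 0 (by decide), harr 1 (by decide), harr 2 (by decide)]
    exact ⟨hX.tail e, hX.head e, hX.weight e⟩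
  · rintro i hi s' f hx ⟨l, hl, hlm, hlv, hli, hl0, hl1, hl2, hrest⟩
    have h5 : s'.arr 5 = s.arr 5 := by rw [f.2 5 rfl, harr 5 (by decide)]
    lift i to Fin m using hi
    obtain ⟨hr0, hr1, hr2⟩ := hrest i le_rfl
    simp only [Cmd.run, eval_get, eval_ne, eval_var, hx, h5, hX.alive]
    split_ifs with h
    · refine ⟨l ++ [i], ?_, fun v => ?_, by simp [hlv], by simpa using hli, ?_, ?_, ?_, ?_⟩
      · rw [List.nodup_append]
        refine ⟨hl, List.nodup_singleton _, fun v hv w hw => ?_⟩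
        rintro rfl
        have := ((hlm v).1 hv).1
        rw [List.mem_singleton.1 hw] at this
        omega
      · rw [List.mem_append, List.mem_singleton, hlm, Fin.ext_iff]
        constructor
        · rintro (h' | h')
          · exact ⟨by omega, h'.2⟩
          · exact ⟨by omega, Fin.ext h' ▸ h⟩
        · rintro ⟨h1, h2⟩
          by_cases h3 : (v : ℕ) = i
          · exact Or.inr h3
          · exact Or.inl ⟨by omega, h2⟩
      · rw [List.map_append]
        exact hl0.append fun j => by simp [hlv, hx, hr0]
      · rw [List.map_append]
        exact hl1.append fun j => by simp [hlv, hx, hr1]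
      · rw [List.map_append]
        exact hl2.append fun j => by simp [hlv, hx, hr2]
      · intro e he
        have : (e : ℕ) ≠ l.length := by omega
        simpa [hlv, this] using hrest e (by omega)
    · refine ⟨l, hl, fun v => ?_, by simp [hlv], by omega, hl0, hl1, hl2,
        fun e he => hrest e (by omega)⟩
      rw [hlm]
      refine and_congr_left fun hv => ?_
      have : (v : ℕ) ≠ i := fun h' => h (Fin.ext h' ▸ hv)
      omega
  refine (Runs.assign (Q := fun s' => s' = s₄.setVar 0 l.length) ?_).seq fun s₅ f₅ e₅ => ?_
  · rw [eval_var, f₄.1 6 rfl, f₃.1 6 rfl, hlv]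
  refine Runs.assign ⟨⟨l, hl, ?_, ?_, ?_⟩, k.map fun e => (X'.tail e, X'.head e), ?_, ?_, ?_, ?_,
    ?_, ?_⟩
  · ext v
    rw [List.mem_toFinset, hlm]
    simp only [v.2, true_and, Ne, hr.marked, not_not]
    rfl
  · simp [e₅]
  · rw [map_val_coe]
    intro j hj
    rw [State.setVar_arr, e₅, State.setVar_arr, f₄.2 3 rfl, f₃.2 3 rfl]
    exact hl3 j hj
  · refine List.Nodup.map_on ?_ hk
    intro e he f hf h
    simp only [Prod.mk.injEq] at h
    exact hr.simple e ((hkm e).1 he).2 f ((hkm f).1 hf).2 h.1 h.2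
  · ext p
    unfold step
    rw [List.mem_toFinset, mem_phi_arcs, ← hr.mat_eq, mat_pos_iff, List.mem_map]
    refine exists_congr fun e => ?_
    rw [hkm, Prod.ext_iff]
    simp
  · simp [e₅, hkv]
  · intro j hj
    rw [State.setVar_arr, e₅, State.setVar_arr]
    rw [hk0 j (by simpa using hj)]
    simp only [List.getElem_map]
    rfl
  · intro j hj
    rw [State.setVar_arr, e₅, State.setVar_arr]
    rw [hk1 j (by simpa using hj)]
    simp only [List.getElem_map]
    rfl
  · intro j hj
    rw [State.setVar_arr, e₅, State.setVar_arr]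
    have hj' : j < k.length := by simpa using hj
    have h1 := hk2 j (by simpa using hj')
    rw [h1]
    simp only [List.getElem_map]
    unfold step
    rw [phi_weight, ← hr.mat_eq]
    exact (hr.simple.mat_eq ((hkm _).1 (List.getElem_mem hj')).2).symm

/-- Append the arc in the variable `5` to the list if it lies in the feedback arc set. -/
def resolveBody : Cmd :=
  .seq (.assign 6 (.var 5)) (.seq (forLoop 7 1 (.assign 6 (.get 5 (.var 6))))
    (.seq (.assign 8 (.not (.ne (.var 6) (.add (.var 1) (.lit 1)))))
      (.seq (.ite (.sub (.var 1) (.var 6))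
        (forLoop 7 2 (.ite (.add (.ne (.get 3 (.var 7)) (.get 0 (.var 6)))
          (.ne (.get 4 (.var 7)) (.get 1 (.var 6)))) .skip (.assign 8 (.lit 1)))) .skip)
        (.ite (.var 8) (.seq (.store 11 (.var 9) (.var 5)) (.assign 9 (.add (.var 9) (.lit 1))))
          .skip))))

/-- After `m` pointer steps the root decides: `m + 1` is selected, `m` is not, and a living arc is
selected when its pair of endpoints occurs in `l`. -/
theorem runs_resolveBody {X : WDigraph (Fin n) (Fin m)} {l : List (Fin n × Fin n)}
    {T : Finset (Fin m)} (s : State)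
    (x : Fin m) (hm : s.var 1 = m) (hl : s.var 2 = l.length) (hlm : l.length ≤ m)
    (h3 : ∀ j (h : j < l.length), s.arr 3 j = (l[j].1 : ℕ))
    (h4 : ∀ j (h : j < l.length), s.arr 4 j = (l[j].2 : ℕ)) (hX : Rep X s.arr)
    (hT : ∀ e, e ∈ T ↔ e ∈ X.arcs ∧ (X.tail e, X.head e) ∈ l)
    (hfix : s.arr 5 ((s.arr 5)^[m] x) = (s.arr 5)^[m] x) (hx : s.var 5 = x) :
    Runs resolveBody s ((m + 1) * 100) fun s' =>
      (Sel T ((s.arr 5)^[m] x) → s'.var 9 = s.var 9 + 1 ∧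
        ∀ j, s'.arr 11 j = if j = s.var 9 then ↑x else s.arr 11 j) ∧
      (¬ Sel T ((s.arr 5)^[m] x) → s'.var 9 = s.var 9 ∧ s'.arr 11 = s.arr 11) := by
  refine Runs.mono (t := 2 + ((m + 1) * 13 + (14 + ((4 + (m + 1) * 37) + 11)))) (Q := fun s' =>
      (Sel T ((s.arr 5)^[m] x) → s'.var 9 = s.var 9 + 1 ∧
        ∀ j, s'.arr 11 j = if j = s.var 9 then ↑x else s.arr 11 j) ∧
      (¬ Sel T ((s.arr 5)^[m] x) → s'.var 9 = s.var 9 ∧ s'.arr 11 = s.arr 11)) ?_ (by omega)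
      fun _ _ h => h
  set r := (s.arr 5)^[m] x with hr
  refine (Runs.assign (Q := fun s' => s' = s.setVar 6 x) (by simp [hx])).seq fun s₁ f₁ e₁ => ?_
  refine (Runs.forLoop_straight (fun i s' => s'.var 6 = (s.arr 5)^[i] x) s₁ (N := m)
    (by rw [f₁.1 1 rfl, hm]) rfl (by decide) rfl rfl (by simp [e₁]) ?_).seq fun s₂ f₂ e₂ => ?_
  · intro i _ s' f _ hI
    rw [Function.iterate_succ_apply']
    simp [Cmd.run, hI, f.2 5 rfl, f₁.2 5 rfl]
  refine (Runs.assign (Q := fun s' => s' = s₂.setVar 8 (if r = m + 1 then 1 else 0)) ?_).seq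
    fun s₃ f₃ e₃ => ?_
  · congr 1
    simp only [Expr.not, Expr.ne, eval_sub, eval_add, eval_lit, eval_var, e₂, ← hr, f₂.1 1 rfl,
      f₁.1 1 rfl, hm]
    split_ifs <;> omega
  have hm₃ : s₃.var 1 = m := by rw [f₃.1 1 rfl, f₂.1 1 rfl, f₁.1 1 rfl, hm]
  have hr₃ : s₃.var 6 = r := by rw [f₃.1 6 rfl, e₂]
  have ha₃ : s₃.arr = s.arr := by
    funext a
    rw [f₃.2 a rfl, f₂.2 a rfl, f₁.2 a rfl]
  have h8₃ : s₃.var 8 = if r = m + 1 then 1 else 0 := by simp [e₃]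
  refine (Runs.ite (t := (m + 1) * 37) (Q := fun s' => s'.var 8 ≠ 0 ↔ Sel T r) (fun h => ?_)
    fun h => ?_).seq fun s₄ f₄ e₄ => ?_
  · have hrm : r < m := by
      simp only [eval_sub, eval_var, hm₃, hr₃] at h
      omega
    clear_value r
    lift r to Fin m using hrm
    refine (Runs.forLoop_straight (fun i s' => s'.var 8 ≠ 0 ↔
      ∃ j, ∃ h : j < l.length, j < i ∧ l[j] = (X.tail r, X.head r)) s₃
      (N := l.length) (by rw [f₃.1 2 rfl, f₂.1 2 rfl, f₁.1 2 rfl, hl]) rfl (by decide) rfl rfl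
      ?_ ?_).mono (Nat.mul_le_mul (by omega) (by decide)) fun s' _ h => ?_
    · have := r.2
      simp [h8₃]
      omega
    · intro i hi s' f hx' hI
      have h1 : l[i] = (X.tail r, X.head r) ↔
          s.arr 3 i = s.arr 0 r ∧ s.arr 4 i = s.arr 1 r := by
        rw [h3 i hi, h4 i hi, hX.tail, hX.head, Prod.ext_iff, Fin.ext_iff, Fin.ext_iff]
      simp only [Cmd.run, eval_add, Nat.add_eq_zero_iff, eval_ne, eval_get, eval_var, hx',
        f.1 6 rfl, hr₃, f.2 3 rfl, f.2 4 rfl, f.2 0 rfl, f.2 1 rfl, ha₃]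
      split_ifs with h2 <;> rw [← h1] at h2
      · simp only [State.setVar_var, eval_lit]
        simp only [Nat.reduceEqDiff, if_false, if_true, ne_eq, one_ne_zero, not_false_eq_true,
          true_iff]
        exact ⟨i, hi, by omega, h2⟩
      · have h5 : s'.var 8 ≠ 0 ↔ ∃ j, ∃ h : j < l.length, j < i + 1 ∧
            l[j] = (X.tail r, X.head r) := by
          rw [hI]
          refine exists_congr fun j => exists_congr fun hj => and_congr_left fun h' => ?_
          have : j ≠ i := by
            rintro rfl
            exact h2 h'
          omega
        simpa using h5
    · rw [h]
      have hra : r ∈ X.arcs := (hX.alive r).1 hfix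
      constructor
      · rintro ⟨j, hj, -, h'⟩
        exact Or.inr ⟨r, (hT r).2 ⟨hra, h' ▸ List.getElem_mem hj⟩, rfl⟩
      · rintro (h' | ⟨e, he, h'⟩)
        · have := r.2
          omega
        · obtain rfl := Fin.ext h'
          obtain ⟨j, hj, h'⟩ := List.getElem_of_mem ((hT e).1 he).2
          exact ⟨j, hj, hj, h'⟩
  · refine (Runs.of_straight .skip rfl s₃ (Q := fun s' => s'.var 8 ≠ 0 ↔ Sel T r) ?_).mono
      (by simp only [Cmd.bound]; omega) fun _ _ h => h
    simp only [eval_sub, eval_var, hm₃, hr₃] at h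
    simp only [Cmd.run, h8₃]
    constructor
    · intro h'
      left
      by_contra h''
      simp [h''] at h'
    · rintro (h' | ⟨e, he, h'⟩)
      · simp [h']
      · have := e.2
        omega
  have h9 : s₄.var 9 = s.var 9 := by rw [f₄.1 9 rfl, f₃.1 9 rfl, f₂.1 9 rfl, f₁.1 9 rfl]
  have h11 : s₄.arr 11 = s.arr 11 := by rw [f₄.2 11 rfl, ha₃]
  have h5 : s₄.var 5 = x := by rw [f₄.1 5 rfl, f₃.1 5 rfl, f₂.1 5 rfl, f₁.1 5 rfl, hx]
  refine (Runs.of_straight _ rfl s₄ ?_).mono (by decide) fun _ _ h => h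
  rw [← e₄]
  simp only [Cmd.run, eval_var]
  split_ifs with h
  · simp [h, h9, h11]
  · simp [h, h9, h11, h5]

/-- The second algorithm after the computation of the essential minor. -/
def writeArcs : Cmd :=
  .seq (.assign 9 (.lit 0)) (.seq (forLoop 5 1 resolveBody)
    (.seq (forLoop 5 9 (.store 0 (.var 5) (.get 11 (.var 5)))) (.assign 0 (.var 9))))

theorem runs_writeArcs {G X X' : WDigraph (Fin n) (Fin m)} {l : List (Fin n × Fin n)} (s : State)
    (hm : s.var 1 = m) (hl : s.var 2 = l.length) (hln : l.Nodup)
    (h3 : ∀ j (h : j < l.length), s.arr 3 j = (l[j].1 : ℕ))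
    (h4 : ∀ j (h : j < l.length), s.arr 4 j = (l[j].2 : ℕ)) (hc : IsCore G X X' s.arr)
    (hlo : X.step.IsOptimalFAS l.toFinset) :
    Runs writeArcs s ((m + 1) * (m + 1) * 200) fun s' =>
      ∃ U : Finset (Fin m), G.IsOptimalFAS U ∧ s'.OutputsArcs U := by
  classical
  obtain ⟨-, hX, hL, hr⟩ := hc
  set T : Finset (Fin m) := X'.arcs.filter fun e => (X'.tail e, X'.head e) ∈ l
  have hT : ∀ e, e ∈ T ↔ e ∈ X'.arcs ∧ (X'.tail e, X'.head e) ∈ l := fun e => Finset.mem_filter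
  have hTo : X'.IsOptimalFAS T :=
    .of_phi hr.simple hr.mat_eq hlo fun e => by rw [hT, List.mem_toFinset]
  -- The pairs in `l` are distinct arcs of the minor, each represented by an arc of `X'`; this keeps
  -- one search linear in `m`.
  have hlm : l.length ≤ m := by
    have h1 : l.toFinset ⊆ X'.arcs.image fun e => (X'.tail e, X'.head e) := by
      intro p hp
      have := hlo.1.1 hp
      unfold step at this
      rw [mem_phi_arcs, ← hr.mat_eq, mat_pos_iff] at this
      obtain ⟨e, he, h1, h2⟩ := this
      exact Finset.mem_image.2 ⟨e, he, Prod.ext h1 h2⟩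
    have h2 := (Finset.card_le_card h1).trans Finset.card_image_le
    rw [List.toFinset_card_of_nodup hln] at h2
    exact h2.trans (by simpa using Finset.card_le_univ X'.arcs)
  obtain ⟨-, -, d, hd, hfix, hlift⟩ := hL
  -- The depth `d` is unknown to the program, but it is at most `m` and further steps stay at the
  -- root.
  have hdm : ∀ x < m, (s.arr 5)^[m] x = (s.arr 5)^[d] x := by
    intro x hx
    have : m = (m - d) + d := by omega
    conv_lhs => rw [this]
    rw [Function.iterate_add_apply, Function.iterate_fixed (hfix x hx)]
  have hU := hlift T hTo (Finset.univ.filter fun x => Sel T ((s.arr 5)^[m] x)) (fun x => by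
    rw [Finset.mem_filter, hdm x x.2]
    simp)
  refine Runs.mono (t := 2 + ((m + 1) * ((m + 1) * 100 + 10) + ((m + 1) * 14 + 2)))
    (Q := fun s' => ∃ U : Finset (Fin m), G.IsOptimalFAS U ∧ s'.OutputsArcs U) ?_ (by nlinarith)
    fun _ _ h => h
  refine (Runs.assign (Q := fun s' => s' = s.setVar 9 0) (by simp)).seq fun s₁ f₁ e₁ => ?_
  -- The result is collected in array `11`, because array `0` still supplies the tails for the
  -- searches.
  refine (Runs.forLoop (N := m) (c := (m + 1) * 100) (fun i s' => ∃ k : List (Fin m), k.Nodup ∧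
    (∀ x, x ∈ k ↔ x < i ∧ Sel T ((s.arr 5)^[m] x)) ∧ s'.var 9 = k.length ∧
      s'.Holds 11 (k.map fun x : Fin m => (x : ℕ))) s₁ (by rw [f₁.1 1 rfl, hm]) (by decide) rfl rfl
      ?_ ?_).seq fun s₂ f₂ ⟨k, hk, hkm, hkv, hk11⟩ => ?_
  · exact ⟨[], by simp, by simp, by simp [e₁], by simp [State.Holds]⟩
  · rintro i hi s' f hx ⟨k, hk, hkm, hkv, hk11⟩
    have harr : ∀ a, a ≠ 11 → s'.arr a = s.arr a := by
      intro a h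
      rw [f.2 a (by simp [forLoop, resolveBody, Cmd.writesArr, h.symm]), f₁.2 a rfl]
    have h5 := harr 5 (by decide)
    lift i to Fin m using hi
    refine (runs_resolveBody (X := X') (T := T) s' i (by rw [f.1 1 rfl, f₁.1 1 rfl, hm])
      (by rw [f.1 2 rfl, f₁.1 2 rfl, hl]) hlm (by rwa [harr 3 (by decide)])
      (by rwa [harr 4 (by decide)]) ⟨?_, ?_, ?_, ?_⟩ hT ?_ hx).mono le_rfl ?_
    · rw [harr 0 (by decide)]
      exact hX.tail
    · rw [harr 1 (by decide)]
      exact hX.head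
    · rw [harr 2 (by decide)]
      exact hX.weight
    · rw [h5]
      exact hX.alive
    · rw [h5, hdm i i.2, hfix i i.2]
    · rintro s'' - ⟨hs1, hs2⟩
      rw [h5] at hs1 hs2
      by_cases hsel : Sel T ((s.arr 5)^[m] i)
      · obtain ⟨h9, h11⟩ := hs1 hsel
        refine ⟨k ++ [i], ?_, fun v => ?_, by simp [h9, hkv], ?_⟩
        · rw [List.nodup_append]
          refine ⟨hk, List.nodup_singleton _, fun v hv w hw => ?_⟩
          rintro rfl
          have := ((hkm v).1 hv).1
          rw [List.mem_singleton.1 hw] at this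
          omega
        · rw [List.mem_append, List.mem_singleton, hkm, Fin.ext_iff]
          constructor
          · rintro (h' | h')
            · exact ⟨by omega, h'.2⟩
            · exact ⟨by omega, Fin.ext h' ▸ hsel⟩
          · rintro ⟨h1, h2⟩
            by_cases h3 : (v : ℕ) = i
            · exact Or.inr h3
            · exact Or.inl ⟨by omega, h2⟩
        · rw [List.map_append]
          exact hk11.append fun j => by rw [State.setVar_arr, h11, hkv, List.length_map]
      · obtain ⟨h9, h11⟩ := hs2 hsel
        refine ⟨k, hk, fun v => ?_, by simp [h9, hkv], fun j hj => ?_⟩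
        · rw [hkm]
          refine and_congr_left fun hv => ?_
          have : (v : ℕ) ≠ i := fun h' => hsel (Fin.ext h' ▸ hv)
          omega
        · rw [State.setVar_arr, h11]
          exact hk11 j hj
  have hkle : k.length ≤ m := by simpa using hk.length_le_card
  refine ((Runs.forLoop_straight (fun i s' => ∀ j < i, s'.arr 0 j = s₂.arr 11 j) s₂ hkv rfl
    (by decide) rfl rfl (by simp) ?_).mono
    (t' := (m + 1) * 14) (Nat.mul_le_mul (Nat.succ_le_succ hkle) (by decide)) fun _ _ h => h).seq
    fun s₃ f₃ h₃ => ?_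
  · intro i _ s' f hx hI j hj
    simp only [Cmd.run, State.setVar_arr, State.setArr_arr, eval_var, eval_get, hx, f.2 11 rfl]
    split_ifs with h
    · rw [h.2]
    · exact hI j (by simp only [true_and] at h; omega)
  refine Runs.assign ⟨_, hU, k, hk, ?_, ?_, ?_⟩
  · ext x
    rw [List.mem_toFinset, hkm]
    simp
  · simp [f₃.1 9 rfl, hkv]
  · rw [map_val_coe]
    intro j hj
    rw [State.setVar_arr, h₃ j (by simpa using hj)]
    exact hk11 j hj

theorem quadratic_bound {n m : ℕ} (h : n ≤ m + 1) :
    (n + m + 1) * (m + 4) * 2000 + (n + m + 1) * 200 ≤ 100000 * (m ^ 2 + 1) ∧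
    (n + m + 1) * (m + 4) * 2000 + (m + 1) * (m + 1) * 200 ≤ 100000 * (m ^ 2 + 1) := by
  have h1 : (n + m + 1) * (m + 4) ≤ (2 * m + 2) * (m + 4) := Nat.mul_le_mul_right _ (by omega)
  have h2 : m ≤ m ^ 2 := by nlinarith [Nat.le_self_pow (n := 2) (by decide) m]
  constructor <;> nlinarith

end Ram

theorem mainTheorem7 :
    (∃ (P : Ram.Cmd) (c : ℕ), ∀ (n m : ℕ) (G : WDigraph (Fin n) (Fin m)),
      G.verts = Finset.univ → G.arcs = Finset.univ → G.Connected →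
      ∃ C : WDigraph (Fin n) (Fin n × Fin n), G.IsEssentialMinor C ∧
        ∃ (t : ℕ) (s : Ram.State), Ram.Exec P (Ram.graphInput G) t s ∧
          t ≤ c * (m ^ 2 + 1) ∧ s.OutputsDigraph C) ∧
    (∃ (Q : Ram.Cmd) (c : ℕ), ∀ (n m : ℕ) (G : WDigraph (Fin n) (Fin m)),
      G.verts = Finset.univ → G.arcs = Finset.univ → G.Connected →
      ∀ C : WDigraph (Fin n) (Fin n × Fin n), G.IsEssentialMinor C →
      ∀ l : List (Fin n × Fin n), l.Nodup → C.IsOptimalFAS l.toFinset →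
        ∃ (t : ℕ) (s : Ram.State), Ram.Exec Q (Ram.graphAndPairsInput G l) t s ∧
          t ≤ c * (m ^ 2 + 1) ∧
          ∃ T : Finset (Fin m), G.IsOptimalFAS T ∧ s.OutputsArcs T) := by
  refine ⟨⟨.seq Ram.core Ram.writeGraph, 100000, fun n m G hv ha hconn => ?_⟩,
    ⟨.seq Ram.core Ram.writeArcs, 100000, fun n m G hv ha hconn C hC l hl hlo => ?_⟩⟩
  · obtain ⟨t₁, s₁, h₁, ht₁, X, X', hX⟩ := Ram.runs_core (Ram.graphInput G) ha rfl rfl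
      (Ram.getD_ofFn _) (Ram.getD_ofFn _) (Ram.getD_ofFn _)
    obtain ⟨t₂, s₂, h₂, ht₂, hs₂⟩ := Ram.runs_writeGraph s₁ (h₁.frame.1 0 rfl)
      (h₁.frame.1 1 rfl) hX
    exact ⟨X.step, hX.minor, _, s₂, .seq h₁ h₂, (Nat.add_le_add ht₁ ht₂).trans
      (Ram.quadratic_bound (hconn.card_le hv)).1, hs₂⟩
  · obtain ⟨t₁, s₁, h₁, ht₁, X, X', hX⟩ := Ram.runs_core (Ram.graphAndPairsInput G l) ha rfl rfl
      (Ram.getD_ofFn _) (Ram.getD_ofFn _) (Ram.getD_ofFn _)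
    -- The list refers to the given minor `C`, which by uniqueness is the one just computed.
    obtain rfl := hC.unique hX.minor
    have h3 : ∀ j (h : j < l.length), s₁.arr 3 j = (l[j].1 : ℕ) := by
      intro j hj
      rw [h₁.frame.2 3 rfl]
      simp [Ram.graphAndPairsInput, Ram.ofList, hj]
    have h4 : ∀ j (h : j < l.length), s₁.arr 4 j = (l[j].2 : ℕ) := by
      intro j hj
      rw [h₁.frame.2 4 rfl]
      simp [Ram.graphAndPairsInput, Ram.ofList, hj]
    obtain ⟨t₂, s₂, h₂, ht₂, hs₂⟩ := Ram.runs_writeArcs s₁ (h₁.frame.1 1 rfl)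
      (h₁.frame.1 2 rfl) hl h3 h4 hX hlo
    exact ⟨_, s₂, .seq h₁ h₂, (Nat.add_le_add ht₁ ht₂).trans
      (Ram.quadratic_bound (hconn.card_le hv)).2, hs₂⟩
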